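/- Let $e>1$ be an odd integer, $q=2^e$, and let $\sigma$ denote the exponent $2^{(e+1)/2}$. Let $\varepsilon\in\mathrm{GF}(q^2)\setminus\mathrm{GF}(q)$ be such that $\varepsilon^2+\varepsilon+\delta=0$ for some $\delta\in\mathrm{GF}(q)\setminus\{1\}$ with absolute trace $\sum_{i=0}^{e-1}\delta^{2^i}=1$. Put $$\Gamma_\varepsilon(x)=[x+(x^q+x)\varepsilon]^{\sigma+2}+(x^q+x)^{\sigma}+(x^{2q}+x^2)\varepsilon+x^{q+1}+x^2 ,$$ and let $\mathcal V^4_\varepsilon$ be the set of $\mathrm{GF}(q^2)$-rational points of the projective hypersurface of $\mathrm{PG}(4,q^2)$, with homogeneous coordinates $(X_0,\dots,X_4)$, whose affine equation (with $x_i=X_i/X_0$) is $$x_4^q+x_4=\Gamma_\varepsilon(x_1)+\Gamma_\varepsilon(x_2)+\Gamma_\varepsilon(x_3),$$ that is, the zero set of the homogenization of this equation with respect to $X_0$. For a non-empty point set $\Omega$ of $\mathrm{PG}(r,q^2)$ and $0\le k\le r$, the $k$-th cutting gap of $\Omega$ is $$\tau_k(\Omega)=k-\min\{\dim\langle\Pi\cap\Omega\rangle:\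 \Pi\text{ a subspace of }\mathrm{PG}(r,q^2),\ \dim\Pi=k\},$$ where dimensions are projective and $\dim\emptyset=-1$. Then $$\tau_1(\mathcal V^4_\varepsilon)=2,\qquad \tau_2(\mathcal V^4_\varepsilon)=2,\qquad \tau_3(\mathcal V^4_\varepsilon)=0 .$$ In particular, there is a line of $\mathrm{PG}(4,q^2)$ disjoint from $\mathcal V^4_\varepsilon$, there is a plane meeting $\mathcal V^4_\varepsilon$ in exactly one point, and every plane of $\mathrm{PG}(4,q^2)$ meets $\mathcal V^4_\varepsilon$ in at least one point. -/

import Mathlib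

open scoped LinearAlgebra.Projectivization

noncomputable section

namespace CuttingGap

/-! ### Cutting gaps of point sets in `PG(r, K)` -/

section Gap

variable {K V : Type*} [Field K] [AddCommGroup V] [Module K V]

/-- The projective dimension of a projective subspace, with `dim ∅ = -1`. -/
def projDim (S : Projectivization.Subspace K V) : ℤ :=
  (Module.finrank K (Projectivization.Subspace.submodule S) : ℤ) - 1

/-- The set of all `dim ⟨Π ∩ Ω⟩`, where `Π` runs over the `k`-dimensional projective subspaces. -/
def sectionDims (Ω : Set (ℙ K V)) (k : ℕ) : Set ℤ :=
  {d | ∃ S : Projectivization.Subspace K V, projDim S = (k : ℤ) ∧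
    d = projDim (Projectivization.Subspace.span ((S : Set (ℙ K V)) ∩ Ω))}

/-- The `k`-th cutting gap `τ_k(Ω) = k - min {dim ⟨Π ∩ Ω⟩ : dim Π = k}`. For `0 ≤ k ≤ r` the set
of integers on the right is nonempty and bounded below by `-1`, so its infimum is its minimum. -/
def cuttingGap (Ω : Set (ℙ K V)) (k : ℕ) : ℤ :=
  (k : ℤ) - sInf (sectionDims Ω k)

end Gap

/-! ### The variety `V^r_ε` of `PG(r, q²)`, `q = 2^e` -/

section Variety

variable {K : Type*} [Field K]

/-- The absolute trace `GF(2^e) → GF(2)`, `x ↦ x + x^2 + x^4 + ⋯ + x^(2^(e-1))`. -/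
def absTrace (e : ℕ) (x : K) : K := ∑ i ∈ Finset.range e, x ^ 2 ^ i

/-- `ε ∈ GF(q²) ∖ GF(q)` and `ε² + ε + δ = 0` for some `δ ∈ GF(q) ∖ {1}` of absolute trace `1`,
where `q = 2^e` and `GF(q) = {x : x^q = x}`. -/
def IsAdmissible (e : ℕ) (ε : K) : Prop :=
  ε ^ 2 ^ e ≠ ε ∧ ∃ δ : K, δ ^ 2 ^ e = δ ∧ δ ≠ 1 ∧ absTrace e δ = 1 ∧ ε ^ 2 + ε + δ = 0

/-- The exponent of `σ : x ↦ x^(2^((e+1)/2))`, for odd `e`. -/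
def sigmaExp (e : ℕ) : ℕ := 2 ^ ((e + 1) / 2)

/-- `Γ_ε(x) = [x + (x^q + x) ε]^(σ+2) + (x^q + x)^σ + (x^(2q) + x²) ε + x^(q+1) + x²`. -/
def Gam (e : ℕ) (ε x : K) : K :=
  (x + (x ^ 2 ^ e + x) * ε) ^ (sigmaExp e + 2) + (x ^ 2 ^ e + x) ^ sigmaExp e
    + (x ^ (2 * 2 ^ e) + x ^ 2) * ε + x ^ (2 ^ e + 1) + x ^ 2

open MvPolynomial in
/-- `Γ_ε(X_i)` made homogeneous of degree `q(σ+2)` by means of the variable `X_0`. -/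
def GamHom (r e : ℕ) (ε : K) (i : Fin (r + 1)) : MvPolynomial (Fin (r + 1)) K :=
  (X i * X 0 ^ (2 ^ e - 1) + (X i ^ 2 ^ e + X i * X 0 ^ (2 ^ e - 1)) * C ε) ^ (sigmaExp e + 2)
    + (X i ^ 2 ^ e + X i * X 0 ^ (2 ^ e - 1)) ^ sigmaExp e * X 0 ^ (2 * 2 ^ e)
    + (X i ^ (2 * 2 ^ e) + X i ^ 2 * X 0 ^ (2 * 2 ^ e - 2)) * C ε * X 0 ^ (2 ^ e * sigmaExp e)
    + X i ^ (2 ^ e + 1) * X 0 ^ (2 ^ e * (sigmaExp e + 2) - (2 ^ e + 1))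
    + X i ^ 2 * X 0 ^ (2 ^ e * (sigmaExp e + 2) - 2)

open MvPolynomial in
/-- The homogenization, with respect to `X_0`, of the affine polynomial
`x_r^q + x_r - (Γ_ε(x_1) + ⋯ + Γ_ε(x_{r-1}))`, which has degree `q(σ+2)`. -/
def varietyPoly (r e : ℕ) (ε : K) : MvPolynomial (Fin (r + 1)) K :=
  X (Fin.last r) ^ 2 ^ e * X 0 ^ (2 ^ e * (sigmaExp e + 2) - 2 ^ e)
    + X (Fin.last r) * X 0 ^ (2 ^ e * (sigmaExp e + 2) - 1)
    - ∑ i ∈ Finset.Ioo 0 (Fin.last r), GamHom r e ε i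

/-- The set of `K`-rational points of `V^r_ε ⊆ PG(r, K)`: the projective hypersurface with affine
equation `x_r^q + x_r = Γ_ε(x_1) + ⋯ + Γ_ε(x_{r-1})`, where `x_i = X_i / X_0`. -/
def variety (r e : ℕ) (ε : K) : Set (ℙ K (Fin (r + 1) → K)) :=
  {P | MvPolynomial.eval P.rep (varietyPoly r e ε) = 0}

/-! The next facts confirm that `varietyPoly` is the homogenization of the affine equation: it is
homogeneous of degree `q(σ+2)`, it becomes the affine equation for `X_0 = 1`, and it does not
vanish identically for `X_0 = 0`. -/

theorem varietyPoly_isHomogeneous (r e : ℕ) (ε : K) :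
    (varietyPoly r e ε).IsHomogeneous (2 ^ e * (sigmaExp e + 2)) := by
  have hq : 1 ≤ 2 ^ e := Nat.one_le_two_pow
  have h2 : 2 ^ e * (sigmaExp e + 2) = 2 ^ e * sigmaExp e + 2 * 2 ^ e := by ring
  have hX : ∀ (i : Fin (r + 1)) (n : ℕ),
      ((MvPolynomial.X i : MvPolynomial (Fin (r + 1)) K) ^ n).IsHomogeneous n := fun i n =>
    MvPolynomial.isHomogeneous_X_pow i n
  have hX1 : ∀ i : Fin (r + 1),
      (MvPolynomial.X i : MvPolynomial (Fin (r + 1)) K).IsHomogeneous 1 := fun i =>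
    MvPolynomial.isHomogeneous_X K i
  have hC := MvPolynomial.isHomogeneous_C (Fin (r + 1)) ε
  have hcast : ∀ {p : MvPolynomial (Fin (r + 1)) K} {m n : ℕ}, p.IsHomogeneous m → m = n →
      p.IsHomogeneous n := fun h hmn => hmn ▸ h
  unfold varietyPoly
  refine ((hcast ((hX _ _).mul (hX _ _)) (by omega)).add
    (hcast ((hX1 _).mul (hX _ _)) (by omega))).sub
    (MvPolynomial.IsHomogeneous.sum _ _ _ fun i _ => ?_)
  unfold GamHom
  have hl : (MvPolynomial.X i * MvPolynomial.X 0 ^ (2 ^ e - 1) :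
      MvPolynomial (Fin (r + 1)) K).IsHomogeneous (2 ^ e) :=
    hcast ((hX1 _).mul (hX _ _)) (by omega)
  have ht := (hX i (2 ^ e)).add hl
  have h1 := (hl.add (hcast (ht.mul hC) (Nat.add_zero _))).pow (sigmaExp e + 2)
  refine (((h1.add (hcast ((ht.pow _).mul (hX _ _)) (by omega))).add
    (hcast ((((hX i (2 * 2 ^ e)).add (hcast ((hX i 2).mul (hX 0 (2 * 2 ^ e - 2)))
      (by omega))).mul hC).mul (hX _ _)) (by omega))).add
    (hcast ((hX _ _).mul (hX _ _)) (by omega))).add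
    (hcast ((hX _ _).mul (hX _ _)) (by omega))

theorem eval_varietyPoly_affine (r e : ℕ) (ε : K) (v : Fin (r + 1) → K) (h0 : v 0 = 1) :
    MvPolynomial.eval v (varietyPoly r e ε) =
      v (Fin.last r) ^ 2 ^ e + v (Fin.last r)
        - ∑ i ∈ Finset.Ioo 0 (Fin.last r), Gam e ε (v i) := by
  simp [varietyPoly, GamHom, Gam, h0]

theorem eval_varietyPoly_infinity (r e : ℕ) (he : e ≠ 0) (ε : K) (v : Fin (r + 1) → K)
    (h0 : v 0 = 0) :
    MvPolynomial.eval v (varietyPoly r e ε) =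
      -∑ i ∈ Finset.Ioo 0 (Fin.last r), (v i ^ 2 ^ e * ε) ^ (sigmaExp e + 2) := by
  have hq : 2 ≤ 2 ^ e := by
    calc 2 = 2 ^ 1 := rfl
      _ ≤ 2 ^ e := Nat.pow_le_pow_right (by norm_num) (Nat.one_le_iff_ne_zero.mpr he)
  have h2 : 2 ^ e * (sigmaExp e + 2) = 2 ^ e * sigmaExp e + 2 * 2 ^ e := by ring
  have hs : 2 ^ e * sigmaExp e ≠ 0 := by unfold sigmaExp; positivity
  have a1 : 2 ^ e - 1 ≠ 0 := by omega
  have a2 : 2 * 2 ^ e ≠ 0 := by omega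
  have a3 : 2 ^ e * (sigmaExp e + 2) - (2 ^ e + 1) ≠ 0 := by omega
  have a4 : 2 ^ e * (sigmaExp e + 2) - 2 ≠ 0 := by omega
  have a5 : 2 ^ e * (sigmaExp e + 2) - 2 ^ e ≠ 0 := by omega
  have a6 : 2 ^ e * (sigmaExp e + 2) - 1 ≠ 0 := by omega
  simp only [varietyPoly, GamHom, map_sub, map_add, map_mul, map_pow, map_sum,
    MvPolynomial.eval_X, MvPolynomial.eval_C, h0, zero_pow a1, zero_pow a2, zero_pow a3,
    zero_pow a4, zero_pow a5, zero_pow a6, zero_pow hs]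
  simp

/-- Membership in `V^r_ε` may be tested on any vector representing the point. -/
theorem mk_mem_variety_iff (r e : ℕ) (ε : K) (v : Fin (r + 1) → K) (hv : v ≠ 0) :
    Projectivization.mk K v hv ∈ variety r e ε ↔
      MvPolynomial.eval v (varietyPoly r e ε) = 0 := by
  obtain ⟨a, ha⟩ := Projectivization.exists_smul_eq_mk_rep K v hv
  have key : MvPolynomial.eval ((a : K) • v) (varietyPoly r e ε) =
      (a : K) ^ (2 ^ e * (sigmaExp e + 2)) * MvPolynomial.eval v (varietyPoly r e ε) := by
    rw [MvPolynomial.eval_eq', MvPolynomial.eval_eq', Finset.mul_sum]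
    refine Finset.sum_congr rfl fun d hd => ?_
    have hdeg : ∑ i, d i = 2 ^ e * (sigmaExp e + 2) := by
      have h := (varietyPoly_isHomogeneous r e ε).degree_eq_sum_deg_support hd
      rw [h]
      exact (Finset.sum_subset (Finset.subset_univ _) fun i _ hi => by simpa using hi).symm
    simp only [Pi.smul_apply, smul_eq_mul, mul_pow, Finset.prod_mul_distrib,
      Finset.prod_pow_eq_pow_sum, hdeg]
    ring
  have ha' : (Projectivization.mk K v hv).rep = (a : K) • v := ha.symm
  simp [variety, ha', key]

end Variety

end CuttingGap

end

/-!
Write `q = 2^e` and `x = a + bε` with `a, b ∈ GF(q)`. Since `ε^q = ε + 1`, one has `b = x^q + x` and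
`a = x + (x^q + x)ε`, and `Γ_ε(x)` becomes the Suzuki–Tits function `f(a, b) = a^(σ+2) + ab + b^σ`
(`coe_gamFixed`). Every plane meets the Suzuki–Tits ovoid in `1` or `q + 1` points, and only one
plane in each parallel class is tangent. So the function `x ↦ Γ_ε(x) + Tr(βx)`, with the relative
trace `Tr`, takes one value once and every other value of `GF(q)` exactly `q + 1` times
(`isOvoidal_gamFixed_add_relTrace`). The elations of the Suzuki group reduce this to `β = 0`, its
similarities then show that the non-zero values are equally frequent, and `f` vanishes only at the
origin.

*Planes.* The variety contains the vertex `P = (0 : 0 : 0 : 0 : 1)`, and at infinity it is the cone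
with vertex `P` over the curve `x₁^(σ+2) + x₂^(σ+2) + x₃^(σ+2) = 0`. This cone meets every plane at
infinity. A plane `π` that is not at infinity and misses `P` lies in `q²` solids that miss `P`. By
the fibre sizes, each of them has at least `q⁵ - q³ + q²` affine points of the variety. Comparing
the sum with the total number of affine points, `π` must contain one
(`exists_mem_affine_plane`).

*Solids.* In a solid that misses `P`, the fibre sizes yield two affine points of the variety that
differ in a prescribed one of `x₁, x₂, x₃` only. Their differences, together with one affine point,
span the solid. A solid through `P` is a cone with vertex `P`, or is the hyperplane at infinity, and
is spanned directly (`le_of_finrank_eq_four`).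

*The extremal plane and line.* Some line of the plane at infinity `x₀ = x₄ = 0` misses the curve
(`exists_external_line`). If `x ↦ x^(σ+2)` is a permutation, then the curve has `q² + 1` points but
is not a line, and projection from a suitable point misses a direction; otherwise a line
`x₁ = c x₂` serves, since the values of `x^(σ+2)` do not form a subfield. Joining that line to `P`
gives a plane that meets the variety in `P` only, and a line of this plane that avoids `P` is
disjoint from the variety.
-/

namespace CuttingGap

open Finset

/-! ### The Suzuki–Tits function -/

theorem sigmaExp_mul_self {e : ℕ} (he : Odd e) : sigmaExp e * sigmaExp e = 2 * 2 ^ e := by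
  obtain ⟨m, rfl⟩ := he
  have : (2 * m + 1 + 1) / 2 = m + 1 := by omega
  rw [sigmaExp, this]
  ring

theorem sigmaExp_ne_zero (e : ℕ) : sigmaExp e ≠ 0 := by
  unfold sigmaExp; positivity

theorem add_pow_sigmaExp {R : Type*} [CommSemiring R] [CharP R 2] (e : ℕ) (x y : R) :
    (x + y) ^ sigmaExp e = x ^ sigmaExp e + y ^ sigmaExp e :=
  add_pow_char_pow x y 2 _

section SuzukiTits

variable {F : Type*} [Field F]

/-- The function `f(a, b) = a^(σ+2) + ab + b^σ`, whose graph is the affine part of the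
Suzuki–Tits ovoid. -/
def suzukiTits (e : ℕ) (p : F × F) : F :=
  p.1 ^ (sigmaExp e + 2) + p.1 * p.2 + p.2 ^ sigmaExp e

variable {e : ℕ}

theorem pow_sigmaExp_sigmaExp (he : Odd e) (hF : ∀ x : F, x ^ 2 ^ e = x) (x : F) :
    (x ^ sigmaExp e) ^ sigmaExp e = x ^ 2 := by
  rw [← pow_mul, sigmaExp_mul_self he, mul_comm, pow_mul, hF]

/-- The similarities of the Suzuki–Tits ovoid that fix the origin and the point at infinity. -/
theorem suzukiTits_scale (he : Odd e) (hF : ∀ x : F, x ^ 2 ^ e = x) (r : F) (p : F × F) :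
    suzukiTits e (r * p.1, r ^ (sigmaExp e + 1) * p.2) =
      r ^ (sigmaExp e + 2) * suzukiTits e p := by
  simp only [suzukiTits]
  rw [mul_pow (r ^ (sigmaExp e + 1)), ← pow_mul, add_mul, one_mul, pow_add r (_ * _), pow_mul,
    pow_sigmaExp_sigmaExp he hF]
  ring

variable [CharP F 2]

/-- The Suzuki–Tits ovoid has a single point in the tangent plane `z = 0`. If `b^σ = b + 1` then
applying `σ` again gives `b² = b`. -/
theorem suzukiTits_eq_zero_iff (he : Odd e) (hF : ∀ x : F, x ^ 2 ^ e = x) (p : F × F) :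
    suzukiTits e p = 0 ↔ p = 0 := by
  have hs := sigmaExp_ne_zero e
  obtain ⟨a, b⟩ := p
  constructor
  · intro h
    simp only [suzukiTits] at h
    by_cases ha : a = 0
    · subst ha
      simp only [zero_mul, add_zero] at h
      rw [zero_pow (by omega), zero_add] at h
      simp [pow_eq_zero_iff hs] at h
      simp [h]
    exfalso
    -- normalise to `a = 1` by the homogeneity of `f`
    obtain ⟨c, rfl⟩ : ∃ c, b = a ^ (sigmaExp e + 1) * c :=
      ⟨b / a ^ (sigmaExp e + 1), by field_simp⟩
    have h1 : a ^ (sigmaExp e + 2) * (1 + c + c ^ sigmaExp e) = 0 := by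
      rw [← h, mul_pow, ← pow_mul, add_mul, one_mul, pow_add a (_ * _), pow_mul,
        pow_sigmaExp_sigmaExp he hF]
      ring
    have h2 : c ^ sigmaExp e = c + 1 := by
      have := (mul_eq_zero.mp h1).resolve_left (pow_ne_zero _ ha)
      rw [add_comm 1 c] at this
      exact (CharTwo.add_eq_zero.mp this).symm
    have h3 : c ^ 2 = c := by
      rw [← pow_sigmaExp_sigmaExp he hF, h2, add_pow_sigmaExp, h2, one_pow, add_assoc,
        CharTwo.add_self_eq_zero, add_zero]
    have h4 : c * (c - 1) = 0 := by linear_combination h3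
    rcases mul_eq_zero.mp h4 with rfl | h4
    · simp [zero_pow hs] at h2
    · rw [sub_eq_zero.mp h4, one_pow] at h2
      simp at h2
  · intro h
    simp only [Prod.mk_eq_zero] at h
    simp [suzukiTits, h.1, h.2, hs]

/-- The elations of the Suzuki group: up to an affine function of `(a, b)`, every translate of
the Suzuki–Tits function along this twisted translation is the function itself. -/
theorem suzukiTits_translate (he : Odd e) (hF : ∀ x : F, x ^ 2 ^ e = x) (u t : F) (p : F × F) :
    suzukiTits e (p.1 + u, p.2 + t + u ^ sigmaExp e * p.1) =
      suzukiTits e p + suzukiTits e (u, t) + u * p.2 + (t + u ^ (sigmaExp e + 1)) * p.1 := by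
  obtain ⟨a, b⟩ := p
  simp only [suzukiTits]
  have h2 : (2 : F) = 0 := CharTwo.two_eq_zero
  rw [pow_add (a + u), add_pow_sigmaExp, add_pow_sigmaExp, add_pow_sigmaExp, mul_pow,
    pow_sigmaExp_sigmaExp he hF]
  linear_combination (a ^ (sigmaExp e) * (a * u + u ^ 2) + u ^ sigmaExp e * (a ^ 2 + a * u)) * h2

theorem pow_sigmaExp_add_two_injective (he : Odd e) (hF : ∀ x : F, x ^ 2 ^ e = x) :
    Function.Injective fun x : F => x ^ (sigmaExp e + 2) := by
  intro x y hxy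
  simp only at hxy
  by_cases hy : y = 0
  · subst hy
    rw [zero_pow (by omega)] at hxy
    exact pow_eq_zero_iff (by omega) |>.mp hxy
  have h1 : (x / y) ^ (sigmaExp e + 2) = 1 := by
    rw [div_pow, hxy, div_self (pow_ne_zero _ hy)]
  set z := x / y
  have hz : z ≠ 0 := by
    rintro h
    rw [h, zero_pow (by omega)] at h1
    exact zero_ne_one h1
  -- raising `z^(σ+2) = 1` to the power `σ` gives `z^(2+2σ) = 1`; divide
  have h2 : (z ^ (sigmaExp e + 2)) ^ sigmaExp e = z ^ (sigmaExp e + 2) * z ^ sigmaExp e := by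
    rw [pow_add, mul_pow, pow_sigmaExp_sigmaExp he hF]
    ring
  have h3 : z ^ sigmaExp e = 1 := by
    rw [h1, one_pow, one_mul] at h2
    exact h2.symm
  have h4 : z ^ 2 = 1 := by
    rw [← pow_sigmaExp_sigmaExp he hF, h3, one_pow]
  have h5 : z = 1 := by
    have h6 : z ^ 2 = 1 ^ 2 := by rw [h4, one_pow]
    exact CharTwo.sq_injective h6
  exact (div_eq_one_iff_eq hy).mp h5

end SuzukiTits

/-! ### Functions with the fibre sizes of an ovoid -/

/-- A function `g : X → A` all of whose fibres have `q + 1` elements, except for one fibre with a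
single element: the heights of the affine points of an ovoid above a plane. -/
def IsOvoidal {X A : Type*} [Fintype X] [DecidableEq A] (q : ℕ) (g : X → A) : Prop :=
  ∃ c₀, ∀ c, #{x | g x = c} = if c = c₀ then 1 else q + 1

theorem IsOvoidal.comp_equiv_add {X Y A : Type*} [Fintype X] [Fintype Y] [DecidableEq A]
    [AddCommGroup A] {q : ℕ} {g : X → A} (hg : IsOvoidal q g) (φ : Y ≃ X) (d : A) {h : Y → A}
    (hh : ∀ y, h y = g (φ y) + d) : IsOvoidal q h := by
  obtain ⟨c₀, hc⟩ := hg
  refine ⟨c₀ + d, fun c => ?_⟩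
  have h1 : #{y | h y = c} = #{x | g x = c - d} := by
    refine Finset.card_equiv φ fun y => ?_
    simp [hh, eq_sub_iff_add_eq]
  rw [h1, hc]
  simp [sub_eq_iff_eq_add]

section Ovoid

variable {F : Type*} [Field F] [CharP F 2] [Fintype F] [DecidableEq F] {e : ℕ}

theorem isOvoidal_suzukiTits (he : Odd e) (hcard : Fintype.card F = 2 ^ e) :
    IsOvoidal (2 ^ e) (suzukiTits e : F × F → F) := by
  have hF : ∀ x : F, x ^ 2 ^ e = x := fun x => hcard ▸ FiniteField.pow_card x
  have hs := sigmaExp_ne_zero e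
  have h0 : #{p : F × F | suzukiTits e p = 0} = 1 := by
    rw [Finset.card_eq_one]
    refine ⟨0, ?_⟩
    ext p
    simp [suzukiTits_eq_zero_iff he hF]
  -- the non-zero fibres are permuted by the similarities
  have h1 : ∀ c : F, c ≠ 0 →
      #{p : F × F | suzukiTits e p = c} = #{p : F × F | suzukiTits e p = 1} := by
    intro c hc
    obtain ⟨r, hr⟩ := Finite.surjective_of_injective (pow_sigmaExp_add_two_injective he hF) c
    simp only at hr
    have hr0 : r ≠ 0 := by
      rintro rfl
      rw [zero_pow (by omega)] at hr
      exact hc hr.symm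
    symm
    refine Finset.card_equiv ((Equiv.mulLeft₀ r hr0).prodCongr
      (Equiv.mulLeft₀ (r ^ (sigmaExp e + 1)) (pow_ne_zero _ hr0))) fun p => ?_
    have := suzukiTits_scale he hF r p
    simp only [mem_filter, mem_univ, true_and]
    change _ ↔ suzukiTits e (r * p.1, r ^ (sigmaExp e + 1) * p.2) = c
    rw [this, hr]
    constructor
    · intro h; rw [h, mul_one]
    · intro h; exact mul_left_cancel₀ hc (by rw [h, mul_one])
  have h2 : Fintype.card (F × F) = ∑ c : F, #{p : F × F | suzukiTits e p = c} :=
    Finset.card_eq_sum_card_fiberwise fun _ _ => Finset.mem_coe.mpr (mem_univ _)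
  rw [← Finset.add_sum_erase _ _ (mem_univ (0 : F)), h0,
    Finset.sum_congr rfl (fun c hc => h1 c (Finset.ne_of_mem_erase hc)), Finset.sum_const,
    Finset.card_erase_of_mem (mem_univ _), Finset.card_univ, Fintype.card_prod, hcard,
    smul_eq_mul] at h2
  have hq : 2 ≤ 2 ^ e := by
    obtain ⟨m, rfl⟩ := he
    rw [pow_succ]
    have := Nat.one_le_two_pow (n := 2 * m)
    omega
  have h3 : #{p : F × F | suzukiTits e p = 1} = 2 ^ e + 1 := by
    obtain ⟨k, hk⟩ : ∃ k, 2 ^ e = k + 2 := ⟨2 ^ e - 2, by omega⟩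
    rw [hk] at h2 ⊢
    have h4 : k + 2 - 1 = k + 1 := rfl
    rw [h4] at h2
    have h5 : (k + 1) * #{p : F × F | suzukiTits e p = 1} = (k + 1) * (k + 2 + 1) := by
      linarith
    exact Nat.eq_of_mul_eq_mul_left (by omega) h5
  refine ⟨0, fun c => ?_⟩
  split_ifs with hc
  · rw [hc, h0]
  · rw [h1 c hc, h3]

/-- Every plane section of the Suzuki–Tits ovoid is a point or has `q + 1` points. -/
theorem isOvoidal_suzukiTits_add_linear (he : Odd e) (hcard : Fintype.card F = 2 ^ e) (l m : F) :
    IsOvoidal (2 ^ e) (fun p : F × F => suzukiTits e p + (l * p.1 + m * p.2)) := by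
  have hF : ∀ x : F, x ^ 2 ^ e = x := fun x => hcard ▸ FiniteField.pow_card x
  set t : F := l + m ^ (sigmaExp e + 1) with ht
  let φ : F × F ≃ F × F :=
    { toFun := fun p => (p.1 + m, p.2 + t + m ^ sigmaExp e * p.1)
      invFun := fun p => (p.1 - m, p.2 - t - m ^ sigmaExp e * (p.1 - m))
      left_inv := fun p => by
        ext
        · simp
        · simp; ring
      right_inv := fun p => by
        ext
        · simp
        · simp; ring }
  refine (isOvoidal_suzukiTits he hcard).comp_equiv_add φ (suzukiTits e (m, t)) fun p => ?_
  have h := suzukiTits_translate he hF m t p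
  have h2 : (2 : F) = 0 := CharTwo.two_eq_zero
  change _ = suzukiTits e (p.1 + m, p.2 + t + m ^ sigmaExp e * p.1) + _
  rw [h, ht]
  linear_combination (- suzukiTits e (m, t) - m ^ (sigmaExp e + 1) * p.1) * h2

end Ovoid

section Count

variable {X A : Type*} [Fintype X] [DecidableEq A] {q : ℕ}

theorem IsOvoidal.surjective {g : X → A} (hg : IsOvoidal q g) : Function.Surjective g := by
  obtain ⟨c₀, hc⟩ := hg
  intro c
  have h : 0 < #{x | g x = c} := by
    rw [hc]
    split_ifs <;> omega
  obtain ⟨x, hx⟩ := Finset.card_pos.mp h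
  exact ⟨x, by simpa using hx⟩

variable [AddCommGroup A]

/-- The sum of three ovoidal functions takes every value at least `q⁵ - q³ + q²` times. -/
theorem IsOvoidal.le_card_add_add (hX : Fintype.card X = q ^ 2) {g : Fin 3 → X → A}
    (hg : ∀ i, IsOvoidal q (g i)) (c : A) :
    (q : ℤ) ^ 5 - q ^ 3 + q ^ 2 ≤
      (#{x : X × X × X | g 0 x.1 + g 1 x.2.1 + g 2 x.2.2 = c} : ℤ) := by
  choose d hd using hg
  have hdZ : ∀ i a, (#{x | g i x = a} : ℤ) = (q + 1) - q * if a = d i then 1 else 0 := by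
    intro i a
    rw [hd]
    split_ifs <;> push_cast <;> ring
  have hsum : ∀ i a, ∑ x, (if g i x = a then (1 : ℤ) else 0) = #{x | g i x = a} := by
    intro i a
    rw [Finset.sum_boole]
  have h2 : ∀ b, ∑ x, ∑ y, (if g 0 x + g 1 y = b then (1 : ℤ) else 0) =
      q ^ 3 - q + q ^ 2 * if b = d 0 + d 1 then 1 else 0 := by
    intro b
    have h3 : ∀ x, ∑ y, (if g 0 x + g 1 y = b then (1 : ℤ) else 0) =
        (q + 1) - q * if g 0 x = b - d 1 then 1 else 0 := by
      intro x
      have h4 : ∀ y, (g 0 x + g 1 y = b) ↔ (g 1 y = b - g 0 x) := fun y => by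
        rw [eq_sub_iff_add_eq']
      have h5 : (b - g 0 x = d 1) ↔ (g 0 x = b - d 1) := by
        rw [sub_eq_iff_eq_add, eq_sub_iff_add_eq', eq_comm]
      simp only [h4, hsum, hdZ, h5]
    have h6 : (b - d 1 = d 0) ↔ (b = d 0 + d 1) := by rw [sub_eq_iff_eq_add]
    simp only [h3, Finset.sum_sub_distrib, ← Finset.mul_sum, hsum, hdZ, h6, Finset.sum_const,
      Finset.card_univ, hX, nsmul_eq_mul]
    push_cast
    ring
  have hcount : (#{x : X × X × X | g 0 x.1 + g 1 x.2.1 + g 2 x.2.2 = c} : ℤ) =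
      ∑ z, ∑ x, ∑ y, (if g 0 x + g 1 y = c - g 2 z then (1 : ℤ) else 0) := by
    rw [← Finset.sum_boole, Fintype.sum_prod_type]
    simp only [Fintype.sum_prod_type]
    conv_rhs => rw [Finset.sum_comm]
    refine Finset.sum_congr rfl fun x _ => ?_
    rw [Finset.sum_comm]
    simp only [eq_sub_iff_add_eq]
  rw [hcount]
  have h7 : ∀ z, (c - g 2 z = d 0 + d 1) ↔ (g 2 z = c - (d 0 + d 1)) := fun z => by
    rw [sub_eq_iff_eq_add, eq_sub_iff_add_eq', eq_comm]
  simp only [h2, h7, Finset.sum_add_distrib, ← Finset.mul_sum, hsum, Finset.sum_const,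
    Finset.card_univ, hX, nsmul_eq_mul, hdZ]
  have hq : (0 : ℤ) ≤ q := Int.natCast_nonneg q
  push_cast
  split_ifs <;> nlinarith [pow_nonneg hq 3]

theorem IsOvoidal.exists_pair (hq : 1 ≤ q) {g h k : X → A} (hg : IsOvoidal q g)
    (hh : IsOvoidal q h) (hk : IsOvoidal q k) (hA : Nontrivial A) (c : A) :
    ∃ x x' y z, x ≠ x' ∧ g x + h y + k z = c ∧ g x' + h y + k z = c := by
  obtain ⟨d, hd⟩ := id hg
  obtain ⟨z, hz⟩ := hk.surjective 0
  obtain ⟨b, hb⟩ := exists_ne (c - d)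
  obtain ⟨y, hy⟩ := hh.surjective b
  have h1 : 1 < #{x | g x = c - b} := by
    rw [hd, if_neg]
    · omega
    · intro h
      exact hb (by rw [← h]; abel)
  obtain ⟨x, hx, x', hx', hne⟩ := Finset.one_lt_card.mp h1
  simp only [mem_filter, mem_univ, true_and] at hx hx'
  refine ⟨x, x', y, z, hne, ?_, ?_⟩
  · rw [hx, hy, hz]; abel
  · rw [hx', hy, hz]; abel

end Count

/-! ### Coordinates over the subfield `GF(q)` -/

theorem pow_pow_self {K : Type*} [Field K] [Fintype K] {e : ℕ}
    (hK : Fintype.card K = (2 ^ e) ^ 2) (x : K) : (x ^ 2 ^ e) ^ 2 ^ e = x := by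
  rw [← pow_mul, ← sq, ← hK, FiniteField.pow_card]

section Coordinates

variable (K : Type*) [Field K] [CharP K 2] (e : ℕ)

/-- The subfield `{x : x^q = x}`, `q = 2^e`, of a field of characteristic `2`. -/
def fixedField : Subfield K where
  carrier := {x | x ^ 2 ^ e = x}
  mul_mem' {a b} ha hb := by
    simp only [Set.mem_ofPred_eq] at ha hb ⊢
    rw [mul_pow, ha, hb]
  one_mem' := one_pow _
  add_mem' {a b} ha hb := by
    simp only [Set.mem_ofPred_eq] at ha hb ⊢
    rw [add_pow_char_pow, ha, hb]
  zero_mem' := zero_pow (by positivity)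
  neg_mem' {a} ha := by
    simp only [Set.mem_ofPred_eq] at ha ⊢
    rw [CharTwo.neg_eq, ha]
  inv_mem' a ha := by
    simp only [Set.mem_ofPred_eq] at ha ⊢
    rw [inv_pow, ha]

variable {K e}

theorem mem_fixedField {x : K} : x ∈ fixedField K e ↔ x ^ 2 ^ e = x := Iff.rfl

theorem fixedField_pow (a : fixedField K e) : (a : K) ^ 2 ^ e = a := a.2

theorem IsAdmissible.pow_eq {ε : K} (hε : IsAdmissible e ε) : ε ^ 2 ^ e = ε + 1 := by
  obtain ⟨h1, δ, h2, -, -, h3⟩ := hε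
  have h4 : (ε ^ 2 ^ e) ^ 2 + ε ^ 2 ^ e + δ = 0 := by
    have := congrArg (· ^ 2 ^ e) h3
    simp only [add_pow_char_pow, h2, ← pow_mul] at this
    rw [← pow_mul, mul_comm, this, zero_pow (by positivity)]
  have h5 : (ε ^ 2 ^ e - ε) * (ε ^ 2 ^ e - (ε + 1)) = 0 := by
    have h2 : (2 : K) = 0 := CharTwo.two_eq_zero
    linear_combination h4 - h3 + (ε ^ 2 - ε * ε ^ 2 ^ e - ε ^ 2 ^ e + ε) * h2
  exact sub_eq_zero.mp ((mul_eq_zero.mp h5).resolve_left (sub_ne_zero.mpr h1))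

/-- This is where `δ ≠ 1` enters: `ε^q = ε + 1` and `ε² = ε + δ`. -/
theorem IsAdmissible.pow_ne_sq {ε : K} (hε : IsAdmissible e ε) : ε ^ 2 ^ e ≠ ε ^ 2 := by
  rw [hε.pow_eq]
  obtain ⟨-, δ, -, h1, -, h3⟩ := hε
  intro h
  apply h1
  have h2 : (2 : K) = 0 := CharTwo.two_eq_zero
  linear_combination h3 + h - (ε ^ 2) * h2 - ε * h2 + (ε ^ 2 - 1) * h2

theorem IsAdmissible.pow_sigmaExp_ne_sq {ε : K} (he : Odd e) (hε : IsAdmissible e ε) :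
    ε ^ sigmaExp e ≠ ε ^ 2 := by
  intro h
  have h1 : (ε ^ sigmaExp e) ^ sigmaExp e = (ε ^ 2) ^ 2 := by
    conv_lhs => rw [h, pow_right_comm, h]
  rw [← pow_mul, sigmaExp_mul_self he, mul_comm, pow_mul] at h1
  exact hε.pow_ne_sq (CharTwo.sq_injective h1)

variable [Fintype K]

/-- The relative trace `GF(q²) → GF(q)`, `x ↦ x^q + x`. -/
def relTrace (hK : Fintype.card K = (2 ^ e) ^ 2) : K →ₗ[fixedField K e] fixedField K e where
  toFun x := ⟨x ^ 2 ^ e + x, by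
    rw [mem_fixedField, add_pow_char_pow, pow_pow_self hK, add_comm]⟩
  map_add' x y := by
    ext
    simp only [add_pow_char_pow, Subfield.coe_add]
    ring
  map_smul' a x := by
    ext
    simp only [Subfield.smul_def, smul_eq_mul, RingHom.id_apply, mul_pow, fixedField_pow,
      Subfield.coe_mul]
    ring

theorem coe_relTrace (hK : Fintype.card K = (2 ^ e) ^ 2) (x : K) :
    (relTrace hK x : K) = x ^ 2 ^ e + x := rfl

theorem relTrace_coe_mul (hK : Fintype.card K = (2 ^ e) ^ 2) (a : fixedField K e) (x : K) :
    relTrace hK (x * a) = relTrace hK x * a := by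
  have := (relTrace hK).map_smul a x
  rw [Subfield.smul_def, smul_eq_mul, mul_comm] at this
  rw [this, smul_eq_mul, mul_comm]

/-- The coordinates `(a, b)` over `GF(q)` of `a + bε`; they are `b = x^q + x` and
`a = x + (x^q + x)ε`. -/
def coordEquiv (hK : Fintype.card K = (2 ^ e) ^ 2) {ε : K} (hε : IsAdmissible e ε) :
    K ≃ fixedField K e × fixedField K e where
  toFun x := (⟨x + (x ^ 2 ^ e + x) * ε, by
    have h2 : (2 : K) = 0 := CharTwo.two_eq_zero
    rw [mem_fixedField]
    simp only [add_pow_char_pow, mul_pow, pow_pow_self hK, hε.pow_eq]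
    linear_combination x ^ 2 ^ e * h2⟩, relTrace hK x)
  invFun p := p.1 + p.2 * ε
  left_inv x := by
    have h2 : (2 : K) = 0 := CharTwo.two_eq_zero
    simp only [coe_relTrace]
    linear_combination (x ^ 2 ^ e + x) * ε * h2
  right_inv p := by
    have h2 : (2 : K) = 0 := CharTwo.two_eq_zero
    ext
    · simp only [add_pow_char_pow, mul_pow, hε.pow_eq, fixedField_pow]
      linear_combination (p.1 * ε + p.2 * ε ^ 2 + p.2 * ε) * h2
    · simp only [coe_relTrace, add_pow_char_pow, mul_pow, hε.pow_eq, fixedField_pow]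
      linear_combination (p.1 + p.2 * ε) * h2

theorem card_fixedField [Fintype (fixedField K e)] (hK : Fintype.card K = (2 ^ e) ^ 2) {ε : K}
    (hε : IsAdmissible e ε) : Fintype.card (fixedField K e) = 2 ^ e := by
  have h := Fintype.card_congr (coordEquiv hK hε)
  rw [hK, Fintype.card_prod, ← sq] at h
  exact (Nat.pow_left_injective (by norm_num : 2 ≠ 0) h).symm

theorem relTrace_surjective (hK : Fintype.card K = (2 ^ e) ^ 2) {ε : K}
    (hε : IsAdmissible e ε) : Function.Surjective (relTrace hK) := fun b => by
  obtain ⟨x, hx⟩ := (coordEquiv hK hε).surjective (0, b)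
  exact ⟨x, congrArg Prod.snd hx⟩

theorem card_relTrace_fiber [DecidableEq (fixedField K e)]
    (hK : Fintype.card K = (2 ^ e) ^ 2) {ε : K} (hε : IsAdmissible e ε) (c : fixedField K e) :
    #{x | relTrace hK x = c} ≤ 2 ^ e := by
  classical
  have := Fintype.ofFinite (fixedField K e)
  rw [← card_fixedField hK hε, ← Finset.card_univ]
  refine Finset.card_le_card_of_injOn (fun x => (coordEquiv hK hε x).1)
    (fun _ _ => Finset.mem_coe.mpr (mem_univ _)) fun x hx y hy hxy => ?_
  simp only [coe_filter, mem_univ, true_and, Set.mem_ofPred_eq] at hx hy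
  exact (coordEquiv hK hε).injective (Prod.ext hxy (hx.trans hy.symm))

/-- The values `Γ_ε(x)`, as elements of `GF(q)`. -/
def gamFixed (hK : Fintype.card K = (2 ^ e) ^ 2) {ε : K} (hε : IsAdmissible e ε) (x : K) :
    fixedField K e :=
  suzukiTits e (coordEquiv hK hε x)

/-- In coordinates `x = a + bε` over `GF(q)`, the function `Γ_ε` is the Suzuki–Tits function. -/
theorem coe_gamFixed (hK : Fintype.card K = (2 ^ e) ^ 2) {ε : K} (hε : IsAdmissible e ε)
    (x : K) : (gamFixed hK hε x : K) = Gam e ε x := by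
  obtain ⟨p, rfl⟩ := (coordEquiv hK hε).symm.surjective x
  rw [gamFixed, Equiv.apply_symm_apply]
  change _ = Gam e ε (p.1 + p.2 * ε)
  have h2 : (2 : K) = 0 := CharTwo.two_eq_zero
  have h1 : ((p.1 : K) + p.2 * ε) ^ 2 ^ e = p.1 + p.2 * (ε + 1) := by
    rw [add_pow_char_pow, mul_pow, hε.pow_eq, fixedField_pow, fixedField_pow]
  have h3 : ((p.1 : K) + p.2 * (ε + 1)) + (p.1 + p.2 * ε) = p.2 := by
    linear_combination (p.1 + p.2 * ε) * h2
  have h4 : (p.1 : K) + p.2 * ε + p.2 * ε = p.1 := by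
    linear_combination p.2 * ε * h2
  rw [Gam, mul_comm 2 (2 ^ e), pow_mul, pow_succ _ (2 ^ e), h1, h3, h4]
  simp only [suzukiTits, Subfield.coe_add, Subfield.coe_mul, SubmonoidClass.coe_pow]
  linear_combination (-((p.1 + p.2 * ε) ^ 2 + (p.1 + p.2 * ε) * p.2) * ε - (p.1 + p.2 * ε) ^ 2
    - p.2 ^ 2 * ε) * h2

/-- The plane sections of the ovoid, in terms of `Γ_ε`. -/
theorem isOvoidal_gamFixed_add_relTrace [DecidableEq (fixedField K e)]
    (hK : Fintype.card K = (2 ^ e) ^ 2) {ε : K} (hε : IsAdmissible e ε) (he : Odd e) (β : K) :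
    IsOvoidal (2 ^ e) fun x => gamFixed hK hε x + relTrace hK (β * x) := by
  have := Fintype.ofFinite (fixedField K e)
  refine (isOvoidal_suzukiTits_add_linear he (card_fixedField hK hε) (relTrace hK β)
    (relTrace hK (β * ε))).comp_equiv_add (coordEquiv hK hε) 0 fun x => ?_
  obtain ⟨p, rfl⟩ := (coordEquiv hK hε).symm.surjective x
  rw [gamFixed, Equiv.apply_symm_apply, add_zero, ← relTrace_coe_mul, ← relTrace_coe_mul,
    ← map_add]
  congr 2
  change β * (p.1 + p.2 * ε) = _
  ring

end Coordinates

/-! ### Affine points of planes and solids -/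

section Affine

variable {K : Type*} [Field K] [Fintype K]

theorem card_affine_plane [DecidableEq K] (d₀ : K) {d : Fin 3 → K} (hd : d ≠ 0) :
    #{x : K × K × K | d₀ + (d 0 * x.1 + d 1 * x.2.1 + d 2 * x.2.2) = 0} =
      Fintype.card K ^ 2 := by
  let f : K × K × K →+ K :=
    { toFun := fun x => d 0 * x.1 + d 1 * x.2.1 + d 2 * x.2.2
      map_zero' := by simp
      map_add' := fun x y => by simp only [Prod.fst_add, Prod.snd_add]; ring }
  have hf : Function.Surjective f := by
    intro c
    obtain ⟨i, hi⟩ := Function.ne_iff.mp hd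
    simp only [Pi.zero_apply] at hi
    fin_cases i
    · exact ⟨(c / d 0, 0, 0), by simp [f]; exact mul_div_cancel₀ c hi⟩
    · exact ⟨(0, c / d 1, 0), by simp [f]; exact mul_div_cancel₀ c hi⟩
    · exact ⟨(0, 0, c / d 2), by simp [f]; exact mul_div_cancel₀ c hi⟩
  have h1 : Fintype.card (K × K × K) = ∑ c : K, #{x | f x = c} :=
    Finset.card_eq_sum_card_fiberwise fun _ _ => Finset.mem_coe.mpr (mem_univ _)
  rw [Finset.sum_congr rfl fun c _ => AddMonoidHom.card_fiber_eq_of_mem_range f (hf c) (hf (-d₀)),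
    Finset.sum_const, Finset.card_univ, smul_eq_mul, Fintype.card_prod, Fintype.card_prod] at h1
  have h2 := Nat.eq_of_mul_eq_mul_left Fintype.card_pos h1
  rw [sq, h2]
  congr 1
  ext x
  simp [f, eq_neg_iff_add_eq_zero, add_comm]

variable [CharP K 2] {e : ℕ}

/-- Every plane that is not at infinity and does not pass through `(0 : 0 : 0 : 0 : 1)` has an
affine point on the variety. The plane is given by two equations `d₀ + d·x = 0` and `y = α + β·x`;
the proof counts the points of the variety in the solids `y = α + β·x + κ (d₀ + d·x)` through it.
Each solid has at least `q⁵ - q³ + q²` of them, while each of the `q⁶ - q⁴` points `x` with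
`d₀ + d·x ≠ 0` accounts for at most `q` of the pairs (solid, point). -/
theorem exists_mem_affine_plane (hK : Fintype.card K = (2 ^ e) ^ 2) {ε : K}
    (hε : IsAdmissible e ε) (he : Odd e) (d₀ α : K) (d β : Fin 3 → K) (hd : d ≠ 0) :
    ∃ x : Fin 3 → K, d₀ + ∑ i, d i * x i = 0 ∧
      ∑ i, gamFixed hK hε (x i) = relTrace hK (α + ∑ i, β i * x i) := by
  classical
  by_contra hnone
  let u : K × K × K → K := fun x => d₀ + (d 0 * x.1 + d 1 * x.2.1 + d 2 * x.2.2)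
  let h : K × K × K → fixedField K e := fun x =>
    gamFixed hK hε x.1 + gamFixed hK hε x.2.1 + gamFixed hK hε x.2.2 -
      relTrace hK (α + (β 0 * x.1 + β 1 * x.2.1 + β 2 * x.2.2))
  have h1 : ∀ κ : K, ((2 ^ e : ℕ) : ℤ) ^ 5 - (2 ^ e : ℕ) ^ 3 + (2 ^ e : ℕ) ^ 2 ≤
      #{x | relTrace hK (κ * u x) = h x} := by
    intro κ
    refine (IsOvoidal.le_card_add_add hK
      (g := fun i x => gamFixed hK hε x + relTrace hK (-(β i + κ * d i) * x))
      (fun i => isOvoidal_gamFixed_add_relTrace hK hε he _) (relTrace hK (α + κ * d₀))).trans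
      (le_of_eq ?_)
    refine congrArg (fun s => (#s : ℤ)) (Finset.filter_congr fun x _ => ?_)
    have h2 : κ * u x = (α + κ * d₀) - -(β 0 + κ * d 0) * x.1 - -(β 1 + κ * d 1) * x.2.1
        - -(β 2 + κ * d 2) * x.2.2 - (α + (β 0 * x.1 + β 1 * x.2.1 + β 2 * x.2.2)) := by
      simp only [u]; ring
    rw [h2, map_sub, map_sub, map_sub, map_sub]
    change _ ↔ _ = _ + _ + _ - relTrace hK _
    constructor <;> intro h <;> linear_combination -h
  have h2 : ∑ κ : K, (#{x | relTrace hK (κ * u x) = h x} : ℤ) =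
      ∑ x, (#{κ : K | relTrace hK (κ * u x) = h x} : ℤ) := by
    simp only [← Finset.sum_boole]
    exact Finset.sum_comm
  have h3 : ∀ x, (#{κ : K | relTrace hK (κ * u x) = h x} : ℤ) ≤
      if u x = 0 then 0 else 2 ^ e := by
    intro x
    split_ifs with hu
    · refine le_of_eq ?_
      rw [Nat.cast_eq_zero, Finset.card_eq_zero, Finset.filter_eq_empty_iff]
      intro κ _ hκ
      rw [hu, mul_zero, map_zero, eq_comm, sub_eq_zero] at hκ
      refine hnone ⟨![x.1, x.2.1, x.2.2], ?_, ?_⟩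
      · simpa [Fin.sum_univ_three, u] using hu
      · simpa [Fin.sum_univ_three] using hκ
    · refine le_trans (Nat.cast_le.mpr ?_)
        (le_of_eq (by push_cast; rfl : ((2 ^ e : ℕ) : ℤ) = 2 ^ e))
      rw [Finset.card_equiv (Equiv.mulRight₀ (u x) hu)
        (t := univ.filter fun y => relTrace hK y = h x) (by simp)]
      exact card_relTrace_fiber hK hε _
  have h4 : ∑ x, (if u x = 0 then (0 : ℤ) else 2 ^ e) = 2 ^ e * ((2 ^ e) ^ 6 - (2 ^ e) ^ 4) := by
    have h5 : ∀ x, (if u x = 0 then (0 : ℤ) else 2 ^ e) =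
        2 ^ e * (1 - if u x = 0 then 1 else 0) := fun x => by split_ifs <;> simp
    simp only [h5, ← Finset.mul_sum, Finset.sum_sub_distrib, Finset.sum_boole, u]
    rw [card_affine_plane d₀ hd, Finset.sum_const, Finset.card_univ, Fintype.card_prod,
      Fintype.card_prod, hK]
    push_cast
    ring
  have h5 := Finset.sum_le_sum fun κ (_ : κ ∈ univ) => h1 κ
  rw [h2, Finset.sum_const, Finset.card_univ, hK, nsmul_eq_mul] at h5
  have h6 := h5.trans ((Finset.sum_le_sum fun x _ => h3 x).trans h4.le)
  push_cast at h6
  have h7 : (0 : ℤ) < (2 ^ e) ^ 4 := by positivity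
  nlinarith

/-- In a solid `y = α + β·x` there are two affine points of the variety that differ, apart from
`y`, in exactly the prescribed coordinate. -/
theorem exists_affine_pair (hK : Fintype.card K = (2 ^ e) ^ 2) {ε : K}
    (hε : IsAdmissible e ε) (he : Odd e) (α : K) (β : Fin 3 → K) (i : Fin 3) :
    ∃ x x' : Fin 3 → K, x i ≠ x' i ∧ (∀ j, j ≠ i → x j = x' j) ∧
      ∑ j, gamFixed hK hε (x j) = relTrace hK (α + ∑ j, β j * x j) ∧
      ∑ j, gamFixed hK hε (x' j) = relTrace hK (α + ∑ j, β j * x' j) := by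
  classical
  have hg := fun i => isOvoidal_gamFixed_add_relTrace hK hε he (-β i)
  have key : ∀ j k : Fin 3, i ≠ j → i ≠ k → j ≠ k →
      ∃ x x' : Fin 3 → K, x i ≠ x' i ∧ (∀ j, j ≠ i → x j = x' j) ∧
      ∑ j, gamFixed hK hε (x j) = relTrace hK (α + ∑ j, β j * x j) ∧
      ∑ j, gamFixed hK hε (x' j) = relTrace hK (α + ∑ j, β j * x' j) := by
    intro j k hij hik hjk
    obtain ⟨a, a', y, z, hne, h1, h2⟩ := IsOvoidal.exists_pair Nat.one_le_two_pow (hg i) (hg j)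
      (hg k) inferInstance (relTrace hK α)
    have hsum : ∀ (f : Fin 3 → fixedField K e), ∑ l, f l = f i + f j + f k := by
      intro f
      have : (univ : Finset (Fin 3)) = {i, j, k} := by
        symm
        rw [← Finset.card_eq_iff_eq_univ, Finset.card_eq_three.mpr ⟨i, j, k, hij, hik, hjk, rfl⟩]
        rfl
      rw [this, Finset.sum_insert (by simp [hij, hik]), Finset.sum_insert (by simp [hjk]),
        Finset.sum_singleton, add_assoc]
    have hx : ∀ b, gamFixed hK hε b + relTrace hK (-β i * b) +
          (gamFixed hK hε y + relTrace hK (-β j * y)) +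
          (gamFixed hK hε z + relTrace hK (-β k * z)) = relTrace hK α →
        ∀ w : Fin 3 → K, w i = b → w j = y → w k = z →
        ∑ j, gamFixed hK hε (w j) = relTrace hK (α + ∑ j, β j * w j) := by
      intro b hb w hi hj hk
      rw [map_add, map_sum, hsum, hsum, hi, hj, hk, ← hb]
      simp only [neg_mul, map_neg]
      ring
    have hw : ∀ b, (fun l => if l = i then b else if l = j then y else z) i = b ∧
        (fun l => if l = i then b else if l = j then y else z) j = y ∧
        (fun l => if l = i then b else if l = j then y else z) k = z := fun b => by
      simp [hij.symm, hik.symm, hjk.symm]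
    refine ⟨fun l => if l = i then a else if l = j then y else z,
      fun l => if l = i then a' else if l = j then y else z, by simpa using hne,
      fun l hl => by simp [hl], hx a h1 _ (hw a).1 (hw a).2.1 (hw a).2.2,
      hx a' h2 _ (hw a').1 (hw a').2.1 (hw a').2.2⟩
  fin_cases i
  · exact key 1 2 (by decide) (by decide) (by decide)
  · exact key 0 2 (by decide) (by decide) (by decide)
  · exact key 0 1 (by decide) (by decide) (by decide)

end Affine

/-! ### The curve at infinity -/

section Infinity

variable {K : Type*} [Field K] [CharP K 2] {e : ℕ}

theorem add_one_pow_sigmaExp_add_two (x : K) :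
    (x + 1) ^ (sigmaExp e + 2) = x ^ (sigmaExp e + 2) + 1 + (x ^ sigmaExp e + x ^ 2) := by
  have h2 : (2 : K) = 0 := CharTwo.two_eq_zero
  rw [pow_add, add_pow_sigmaExp, one_pow]
  linear_combination (x ^ sigmaExp e * x + x) * h2

/-- The point `(ε : 1 : ε + 1)` of the line `x₁ + x₂ + x₃ = 0` is not on the curve. -/
theorem IsAdmissible.add_one_pow_ne {ε : K} (he : Odd e) (hε : IsAdmissible e ε) :
    (ε + 1) ^ (sigmaExp e + 2) ≠ ε ^ (sigmaExp e + 2) + 1 := by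
  rw [add_one_pow_sigmaExp_add_two]
  intro h
  exact hε.pow_sigmaExp_ne_sq he (CharTwo.add_eq_zero.mp (add_eq_left.mp h))

variable [Fintype K]

/-- The curve `x₁^(σ+2) + x₂^(σ+2) + x₃^(σ+2) = 0` is not the line `x₁ + x₂ + x₃ = 0`, with which
it shares `(1 : 1 : 0)` and `(1 : 0 : 1)`. -/
theorem exists_sum_pow_eq_zero_sum_ne_zero {ε : K} (he : Odd e) (hε : IsAdmissible e ε) :
    ∃ x : Fin 3 → K, ∑ i, x i ^ (sigmaExp e + 2) = 0 ∧ ∑ i, x i ≠ 0 := by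
  by_cases hinj : Function.Injective fun x : K => x ^ (sigmaExp e + 2)
  · obtain ⟨t, ht⟩ := Finite.surjective_of_injective hinj (ε ^ (sigmaExp e + 2) + 1)
    simp only at ht
    refine ⟨![ε, 1, t], ?_, ?_⟩
    · simp [Fin.sum_univ_three, ht, CharTwo.add_self_eq_zero]
    · simp only [Fin.sum_univ_three, Matrix.cons_val]
      intro h
      rw [← CharTwo.add_eq_zero.mp h] at ht
      exact hε.add_one_pow_ne he ht
  · simp only [Function.Injective, not_forall] at hinj
    obtain ⟨a, b, hab, hne⟩ := hinj
    refine ⟨![a, b, 0], ?_, ?_⟩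
    · simp [Fin.sum_univ_three, hab, CharTwo.add_self_eq_zero]
    · simpa [Fin.sum_univ_three, CharTwo.add_eq_zero] using hne

/-- If `x ↦ x^(σ+2)` permutes `GF(q²)`, projection of the curve from the point `(1 : ε : ε + 1)`,
which is off the curve, is a map between sets of the same size that identifies `(1 : 1 : 0)` with
`(0 : 1 : 1)`. So it misses a point, that is, some line through the centre misses the curve. -/
theorem exists_external_line_of_injective {ε : K} (he : Odd e) (hε : IsAdmissible e ε)
    (hinj : Function.Injective fun x : K => x ^ (sigmaExp e + 2)) :
    ∃ d : Fin 3 → K, d ≠ 0 ∧ ∀ x : Fin 3 → K, ∑ i, d i * x i = 0 →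
      ∑ i, x i ^ (sigmaExp e + 2) = 0 → x = 0 := by
  have h2 : (2 : K) = 0 := CharTwo.two_eq_zero
  have hsurj := Finite.surjective_of_injective hinj
  choose r hr using hsurj
  simp only at hr
  -- the points of the cone over the curve are `(w y z, y, z)`
  let w : K → K → K := fun y z => r (y ^ (sigmaExp e + 2) + z ^ (sigmaExp e + 2))
  have hw : ∀ x y z, x ^ (sigmaExp e + 2) + y ^ (sigmaExp e + 2) + z ^ (sigmaExp e + 2) = 0 →
      w y z = x := by
    intro x y z h
    apply hinj
    simp only [w, hr]
    rw [add_assoc] at h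
    exact (CharTwo.add_eq_zero.mp h).symm
  have hε1 : ε + 1 ≠ 0 := by
    intro h
    have h3 := hε.add_one_pow_ne he
    rw [CharTwo.add_eq_zero.mp h, one_pow, CharTwo.add_self_eq_zero, zero_pow (by omega)] at h3
    exact h3 rfl
  let θ : K × K → K × K := fun p => (p.1 + ε * w p.1 p.2, p.2 + (ε + 1) * w p.1 p.2)
  have hθ : ¬ Function.Injective θ := by
    intro h
    have h3 : w 1 0 = 1 := hw 1 1 0 (by simp [CharTwo.add_self_eq_zero])
    have h4 : w (ε + 1) (ε + 1) = 0 := hw 0 _ _ (by simp [CharTwo.add_self_eq_zero])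
    have h5 : θ (1, 0) = θ (ε + 1, ε + 1) := by
      simp only [θ, h3, h4]
      ext <;> simp [add_comm]
    exact hε1 (congrArg Prod.snd (h h5)).symm
  rw [Finite.injective_iff_surjective] at hθ
  simp only [Function.Surjective, not_forall, not_exists] at hθ
  obtain ⟨⟨a, b⟩, hab⟩ := hθ
  have hab0 : ¬ (a = 0 ∧ b = 0) := by
    rintro ⟨rfl, rfl⟩
    apply hab (0, 0)
    have : w 0 0 = 0 := hw 0 0 0 (by simp)
    simp [θ, this]
  refine ⟨![b * ε + a * (ε + 1), b, a], ?_, ?_⟩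
  · intro h
    apply hab0
    have h3 := congrFun h 1
    have h4 := congrFun h 2
    simp only [Matrix.cons_val, Pi.zero_apply] at h3 h4
    exact ⟨h4, h3⟩
  intro x hx hC
  simp only [Fin.sum_univ_three, Matrix.cons_val] at hx hC
  -- `x` projects to a multiple `k` of `(a, b)`
  obtain ⟨k, hk1, hk2⟩ : ∃ k, x 1 + ε * x 0 = k * a ∧ x 2 + (ε + 1) * x 0 = k * b := by
    have h3 : b * (x 1 + ε * x 0) = a * (x 2 + (ε + 1) * x 0) := by
      linear_combination hx - a * (x 2 + (ε + 1) * x 0) * h2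
    by_cases ha : a = 0
    · have hb : b ≠ 0 := fun hb => hab0 ⟨ha, hb⟩
      rw [ha, zero_mul] at h3
      refine ⟨(x 2 + (ε + 1) * x 0) / b, ?_, by field_simp⟩
      rw [(mul_eq_zero.mp h3).resolve_left hb, ha, mul_zero]
    · refine ⟨(x 1 + ε * x 0) / a, by field_simp, ?_⟩
      field_simp
      linear_combination -h3
  have hk : k = 0 := by
    by_contra hk
    apply hab (k⁻¹ * x 1, k⁻¹ * x 2)
    have h3 : w (k⁻¹ * x 1) (k⁻¹ * x 2) = k⁻¹ * x 0 := by
      apply hw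
      rw [mul_pow, mul_pow, mul_pow, ← mul_add, ← mul_add, hC, mul_zero]
    simp only [θ, h3]
    ext
    · simp only
      field_simp
      linear_combination hk1
    · simp only
      field_simp
      linear_combination hk2
  rw [hk, zero_mul] at hk1 hk2
  have h1 : x 1 = ε * x 0 := CharTwo.add_eq_zero.mp hk1
  have h3 : x 2 = (ε + 1) * x 0 := CharTwo.add_eq_zero.mp hk2
  have h0 : x 0 = 0 := by
    rw [h1, h3, mul_pow, mul_pow] at hC
    have h4 : x 0 ^ (sigmaExp e + 2) *
        (ε ^ (sigmaExp e + 2) + 1 + (ε + 1) ^ (sigmaExp e + 2)) = 0 := by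
      linear_combination hC
    refine pow_eq_zero_iff (by omega) |>.mp ((mul_eq_zero.mp h4).resolve_right fun h => ?_)
    exact hε.add_one_pow_ne he (CharTwo.add_eq_zero.mp h).symm
  ext i
  fin_cases i
  · exact h0
  · simp [h1, h0]
  · simp [h3, h0]

/-- If the range `L` of `x ↦ x^(σ+2)` were closed under adding `1`, it would be a subring. It would
contain `x^σ + x²` for all `x`, hence also `u^σ (x^σ + x²) + ((ux)^σ + (ux)²) = (u^σ + u²) x²` for
`u ∈ L`, and so it would be the whole field. -/
theorem exists_add_one_notMem_range {ε : K} (he : Odd e) (hε : IsAdmissible e ε)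
    (hinj : ¬ Function.Injective fun x : K => x ^ (sigmaExp e + 2)) :
    ∃ c : K, c ^ (sigmaExp e + 2) + 1 ∉ Set.range fun x : K => x ^ (sigmaExp e + 2) := by
  by_contra! hcl
  apply hinj
  rw [Finite.injective_iff_surjective]
  set L : Set K := Set.range fun x : K => x ^ (sigmaExp e + 2) with hL
  have hmul : ∀ a ∈ L, ∀ b ∈ L, a * b ∈ L := by
    rintro _ ⟨a, rfl⟩ _ ⟨b, rfl⟩
    exact ⟨a * b, mul_pow _ _ _⟩
  have hadd : ∀ a ∈ L, ∀ b ∈ L, a + b ∈ L := by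
    rintro _ ⟨a, rfl⟩ _ ⟨b, rfl⟩
    simp only
    by_cases hb : b = 0
    · rw [hb, zero_pow (by omega), add_zero]
      exact ⟨a, rfl⟩
    have h1 : a ^ (sigmaExp e + 2) + b ^ (sigmaExp e + 2) =
        b ^ (sigmaExp e + 2) * ((a / b) ^ (sigmaExp e + 2) + 1) := by
      rw [mul_add, ← mul_pow, mul_div_cancel₀ _ hb, mul_one]
    rw [h1]
    exact hmul _ ⟨b, rfl⟩ _ (hcl _)
  have hone : (1 : K) ∈ L := ⟨1, one_pow _⟩
  have hpow : ∀ a ∈ L, ∀ n : ℕ, a ^ n ∈ L := by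
    intro a ha n
    induction n with
    | zero => simpa using hone
    | succ n ih => rw [pow_succ]; exact hmul _ ih _ ha
  have h2 : (2 : K) = 0 := CharTwo.two_eq_zero
  have h1 : ∀ x : K, x ^ sigmaExp e + x ^ 2 ∈ L := by
    intro x
    have h3 := add_one_pow_sigmaExp_add_two (e := e) x
    have h4 : x ^ sigmaExp e + x ^ 2 =
        (x + 1) ^ (sigmaExp e + 2) + (x ^ (sigmaExp e + 2) + 1) := by
      linear_combination -h3 - (x ^ (sigmaExp e + 2) + 1) * h2
    rw [h4]
    exact hadd _ ⟨_, rfl⟩ _ (hadd _ ⟨_, rfl⟩ _ hone)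
  have h3 : ∀ u ∈ L, ∀ x : K, (u ^ sigmaExp e + u ^ 2) * x ^ 2 ∈ L := by
    intro u hu x
    have h4 : (u ^ sigmaExp e + u ^ 2) * x ^ 2 =
        u ^ sigmaExp e * (x ^ sigmaExp e + x ^ 2) + ((u * x) ^ sigmaExp e + (u * x) ^ 2) := by
      rw [mul_pow u x (sigmaExp e)]
      linear_combination (-u ^ sigmaExp e * x ^ sigmaExp e) * h2
    rw [h4]
    exact hadd _ (hmul _ (hpow _ hu _) _ (h1 _)) _ (h1 _)
  set u := ε ^ (sigmaExp e + 2) with hu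
  have hε0 : ε ≠ 0 := by
    rintro rfl
    exact hε.pow_sigmaExp_ne_sq he (by rw [zero_pow (sigmaExp_ne_zero e), zero_pow two_ne_zero])
  have hu0 : u ^ sigmaExp e + u ^ 2 ≠ 0 := by
    intro h
    have h4 := CharTwo.add_eq_zero.mp h
    have h5 : ε ^ (sigmaExp e * 2) * (ε ^ 2 ^ e) ^ 2 = ε ^ (sigmaExp e * 2) * (ε ^ 2) ^ 2 := by
      calc ε ^ (sigmaExp e * 2) * (ε ^ 2 ^ e) ^ 2
          = ε ^ (sigmaExp e * 2) * ε ^ (sigmaExp e * sigmaExp e) := by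
            rw [sigmaExp_mul_self he, ← pow_mul, mul_comm 2 (2 ^ e)]
        _ = u ^ sigmaExp e := by
            rw [hu, ← pow_mul, ← pow_add]
            congr 1
            ring
        _ = ε ^ (sigmaExp e * 2) * (ε ^ 2) ^ 2 := by
            rw [h4, hu]
            ring
    have h6 := mul_left_cancel₀ (pow_ne_zero _ hε0) h5
    exact hε.pow_ne_sq (CharTwo.sq_injective h6)
  intro y
  obtain ⟨x, hx⟩ := Finite.surjective_of_injective (CharTwo.sq_injective (R := K))
    (y / (u ^ sigmaExp e + u ^ 2))
  simp only at hx
  have h4 := h3 u ⟨ε, rfl⟩ x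
  rw [hx, mul_div_cancel₀ _ hu0] at h4
  exact h4

/-- Some line of the plane misses the curve `x₁^(σ+2) + x₂^(σ+2) + x₃^(σ+2) = 0`. When `σ + 2` is
not prime to `q² - 1`, there is one of the form `x₁ = c x₂`. -/
theorem exists_external_line {ε : K} (he : Odd e) (hε : IsAdmissible e ε) :
    ∃ d : Fin 3 → K, d ≠ 0 ∧ ∀ x : Fin 3 → K, ∑ i, d i * x i = 0 →
      ∑ i, x i ^ (sigmaExp e + 2) = 0 → x = 0 := by
  by_cases hinj : Function.Injective fun x : K => x ^ (sigmaExp e + 2)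
  · exact exists_external_line_of_injective he hε hinj
  obtain ⟨c, hc⟩ := exists_add_one_notMem_range he hε hinj
  refine ⟨![1, c, 0], fun h => one_ne_zero (α := K) (congrFun h 0), fun x hx hC => ?_⟩
  simp only [Fin.sum_univ_three, Matrix.cons_val] at hx hC
  have h0 : x 0 = c * x 1 := by
    apply CharTwo.add_eq_zero.mp
    linear_combination hx
  rw [h0, mul_pow] at hC
  have h1 : x 1 = 0 := by
    by_contra h1
    apply hc
    refine ⟨x 2 / x 1, ?_⟩
    simp only
    have h3 : x 2 ^ (sigmaExp e + 2) =
        c ^ (sigmaExp e + 2) * x 1 ^ (sigmaExp e + 2) + x 1 ^ (sigmaExp e + 2) :=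
      (CharTwo.add_eq_zero.mp hC).symm
    rw [div_pow, h3, div_eq_iff (pow_ne_zero _ h1)]
    ring
  have h2 : x 2 = 0 := by
    rw [h1, zero_pow (by omega), mul_zero, zero_add, zero_add] at hC
    exact pow_eq_zero_iff (by omega) |>.mp hC
  ext i
  fin_cases i
  · simp [h0, h1]
  · exact h1
  · exact h2

end Infinity

/-! ### Sections of the variety by linear subspaces -/

section Sections

variable {K : Type*} [Field K] {e : ℕ}

theorem linearMap_apply_fin_five (φ : (Fin 5 → K) →ₗ[K] K) (v : Fin 5 → K) :
    φ v = v 0 * φ (Pi.single 0 1) + v 1 * φ (Pi.single 1 1) + v 2 * φ (Pi.single 2 1) +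
      v 3 * φ (Pi.single 3 1) + v 4 * φ (Pi.single 4 1) := by
  conv_lhs => rw [pi_eq_sum_univ' v]
  simp [Fin.sum_univ_five, Pi.single]

theorem finrank_ker_of_ne_zero {φ : (Fin 5 → K) →ₗ[K] K} (hφ : φ ≠ 0) :
    Module.finrank K (LinearMap.ker φ) = 4 := by
  have h := Module.Dual.finrank_ker_add_one_of_ne_zero hφ
  simp only [Module.finrank_fintype_fun_eq_card, Fintype.card_fin] at h
  omega

theorem Ioo_zero_last_four : Finset.Ioo (0 : Fin 5) (Fin.last 4) = {1, 2, 3} := by decide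

theorem sum_Ioo_zero_last_four {M : Type*} [AddCommMonoid M] (f : Fin 5 → M) :
    ∑ i ∈ Finset.Ioo (0 : Fin 5) (Fin.last 4), f i = f 1 + f 2 + f 3 := by
  rw [Ioo_zero_last_four, Finset.sum_insert (by decide), Finset.sum_insert (by decide),
    Finset.sum_singleton, add_assoc]

variable [CharP K 2]

theorem eval_varietyPoly_eq_zero_iff_of_zero {ε : K} (he : Odd e) (hε : IsAdmissible e ε)
    {v : Fin 5 → K} (h0 : v 0 = 0) :
    MvPolynomial.eval v (varietyPoly 4 e ε) = 0 ↔
      v 1 ^ (sigmaExp e + 2) + v 2 ^ (sigmaExp e + 2) + v 3 ^ (sigmaExp e + 2) = 0 := by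
  have hε0 : ε ≠ 0 := by
    rintro rfl
    exact hε.1 (zero_pow (by positivity))
  have h1 : (v 1 ^ 2 ^ e * ε) ^ (sigmaExp e + 2) + (v 2 ^ 2 ^ e * ε) ^ (sigmaExp e + 2) +
      (v 3 ^ 2 ^ e * ε) ^ (sigmaExp e + 2) =
      (v 1 ^ (sigmaExp e + 2) + v 2 ^ (sigmaExp e + 2) + v 3 ^ (sigmaExp e + 2)) ^ 2 ^ e *
        ε ^ (sigmaExp e + 2) := by
    rw [add_pow_char_pow, add_pow_char_pow, add_mul, add_mul]
    simp only [mul_pow, ← pow_mul, mul_comm (2 ^ e)]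
  rw [eval_varietyPoly_infinity 4 e he.pos.ne' ε v h0, neg_eq_zero, sum_Ioo_zero_last_four, h1,
    mul_eq_zero, or_iff_left (pow_ne_zero _ hε0), pow_eq_zero_iff (by positivity)]

theorem eval_varietyPoly_eq_zero_iff_of_one [Fintype K] (hK : Fintype.card K = (2 ^ e) ^ 2)
    {ε : K} (hε : IsAdmissible e ε) {v : Fin 5 → K} (h0 : v 0 = 1) :
    MvPolynomial.eval v (varietyPoly 4 e ε) = 0 ↔
      gamFixed hK hε (v 1) + gamFixed hK hε (v 2) + gamFixed hK hε (v 3) =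
        relTrace hK (v 4) := by
  rw [eval_varietyPoly_affine 4 e ε v h0, sum_Ioo_zero_last_four, sub_eq_zero, eq_comm,
    Subtype.ext_iff]
  simp only [Subfield.coe_add, coe_gamFixed, coe_relTrace]
  rfl

theorem eval_varietyPoly_single_last {ε : K} (he : Odd e) (hε : IsAdmissible e ε) (t : K) :
    MvPolynomial.eval (Pi.single 4 t) (varietyPoly 4 e ε) = 0 := by
  rw [eval_varietyPoly_eq_zero_iff_of_zero he hε (by simp)]
  simp

variable [Fintype K]

/-- Every plane meets the variety. -/
theorem exists_mem_of_finrank_eq_three (hK : Fintype.card K = (2 ^ e) ^ 2) {ε : K}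
    (hε : IsAdmissible e ε) (he : Odd e) {W : Submodule K (Fin 5 → K)}
    (hW : Module.finrank K W = 3) :
    ∃ v ∈ W, v ≠ 0 ∧ MvPolynomial.eval v (varietyPoly 4 e ε) = 0 := by
  by_cases hlast : (Pi.single 4 1 : Fin 5 → K) ∈ W
  · exact ⟨_, hlast, by simp, eval_varietyPoly_single_last he hε 1⟩
  by_cases hinf : ∀ v ∈ W, v 0 = 0
  · -- a plane at infinity meets the cone in a point with `x₁ = x₂` and `x₃ = 0`
    let f : W →ₗ[K] K × K :=
      ((LinearMap.proj (R := K) (φ := fun _ : Fin 5 => K) 1 - LinearMap.proj 2).prod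
        (LinearMap.proj 3)).comp W.subtype
    have hf : LinearMap.ker f ≠ ⊥ := by
      apply LinearMap.ker_ne_bot_of_finrank_lt
      rw [hW, Module.finrank_prod, Module.finrank_self]
      norm_num
    obtain ⟨⟨v, hv⟩, hvf, hv0⟩ := Submodule.exists_mem_ne_zero_of_ne_bot hf
    have h1 : v 1 - v 2 = 0 := congrArg Prod.fst (LinearMap.mem_ker.mp hvf)
    have h3 : v 3 = 0 := congrArg Prod.snd (LinearMap.mem_ker.mp hvf)
    refine ⟨v, hv, fun h => hv0 (Subtype.ext h), ?_⟩
    rw [eval_varietyPoly_eq_zero_iff_of_zero he hε (hinf v hv), sub_eq_zero.mp h1, h3,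
      CharTwo.add_self_eq_zero, zero_add, zero_pow (by omega)]
  -- otherwise the plane is cut out by a form `φ` that vanishes at the vertex and a form `ψ` that
  -- does not
  simp only [not_forall] at hinf
  obtain ⟨w, hw, hw0⟩ := hinf
  obtain ⟨ψ, hψ, hWψ⟩ := Submodule.exists_le_ker_of_notMem hlast
  have hlt : W ⊔ K ∙ (Pi.single 4 1 : Fin 5 → K) < ⊤ := by
    rw [lt_top_iff_ne_top]
    intro h
    have h1 := Submodule.finrank_add_le_finrank_add_finrank W (K ∙ (Pi.single 4 1 : Fin 5 → K))
    rw [h, finrank_top, Module.finrank_fintype_fun_eq_card, Fintype.card_fin, hW,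
      finrank_span_singleton (by simp)] at h1
    omega
  obtain ⟨φ, hφ, hWφ⟩ := Submodule.exists_le_ker_of_lt_top _ hlt
  have hφ4 : φ (Pi.single 4 1) = 0 :=
    hWφ (Submodule.mem_sup_right (Submodule.mem_span_singleton_self _))
  have hWeq : W = LinearMap.ker φ ⊓ LinearMap.ker ψ := by
    apply Submodule.eq_of_le_of_finrank_le (le_inf (le_sup_left.trans hWφ) hWψ)
    have h1 : LinearMap.ker φ ⊓ LinearMap.ker ψ < LinearMap.ker φ := by
      refine lt_of_le_of_ne inf_le_left fun h => hψ ?_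
      have h2 : (Pi.single 4 1 : Fin 5 → K) ∈ LinearMap.ker φ := hφ4
      rw [← h] at h2
      exact h2.2
    have h2 := Submodule.finrank_lt_finrank_of_lt h1
    rw [finrank_ker_of_ne_zero hφ] at h2
    omega
  have hd : (![φ (Pi.single 1 1), φ (Pi.single 2 1), φ (Pi.single 3 1)] : Fin 3 → K) ≠ 0 := by
    intro h
    have h1 : φ (Pi.single 1 1) = 0 := congrFun h 0
    have h2 : φ (Pi.single 2 1) = 0 := congrFun h 1
    have h3 : φ (Pi.single 3 1) = 0 := congrFun h 2
    have h4 : φ w = 0 := hWφ (Submodule.mem_sup_left hw)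
    rw [linearMap_apply_fin_five, h1, h2, h3, hφ4] at h4
    have h5 : φ (Pi.single 0 1) = 0 := by simpa [hw0] using h4
    refine hφ (LinearMap.ext fun v => ?_)
    rw [linearMap_apply_fin_five φ v, h1, h2, h3, hφ4, h5]
    simp
  obtain ⟨x, hx1, hx2⟩ := exists_mem_affine_plane hK hε he (φ (Pi.single 0 1))
    (-ψ (Pi.single 0 1) / ψ (Pi.single 4 1)) _
    (fun i => -![ψ (Pi.single 1 1), ψ (Pi.single 2 1), ψ (Pi.single 3 1)] i /
      ψ (Pi.single 4 1)) hd
  simp only [Fin.sum_univ_three, Matrix.cons_val] at hx1 hx2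
  set y := -ψ (Pi.single 0 1) / ψ (Pi.single 4 1) +
    (-ψ (Pi.single 1 1) / ψ (Pi.single 4 1) * x 0 + -ψ (Pi.single 2 1) / ψ (Pi.single 4 1) * x 1 +
      -ψ (Pi.single 3 1) / ψ (Pi.single 4 1) * x 2) with hy
  refine ⟨![1, x 0, x 1, x 2, y], ?_, fun h => one_ne_zero (α := K) (congrFun h 0), ?_⟩
  · rw [hWeq]
    constructor
    · rw [SetLike.mem_coe, LinearMap.mem_ker, linearMap_apply_fin_five, hφ4]
      simp only [Matrix.cons_val]
      linear_combination hx1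
    · rw [SetLike.mem_coe, LinearMap.mem_ker, linearMap_apply_fin_five]
      simp only [Matrix.cons_val]
      rw [hy]
      field_simp
      ring
  · rw [eval_varietyPoly_eq_zero_iff_of_one hK hε (by simp)]
    exact hx2

/-- The points of the variety in a solid span it. -/
theorem le_of_finrank_eq_four (hK : Fintype.card K = (2 ^ e) ^ 2) {ε : K}
    (hε : IsAdmissible e ε) (he : Odd e) {W U : Submodule K (Fin 5 → K)}
    (hW : Module.finrank K W = 4)
    (hU : ∀ v ∈ W, MvPolynomial.eval v (varietyPoly 4 e ε) = 0 → v ∈ U) : W ≤ U := by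
  by_cases hlast : (Pi.single 4 1 : Fin 5 → K) ∈ W
  · have hlastU : (Pi.single 4 1 : Fin 5 → K) ∈ U :=
      hU _ hlast (eval_varietyPoly_single_last he hε 1)
    by_cases hinf : ∀ v ∈ W, v 0 = 0
    · -- the hyperplane at infinity
      have hWeq : W = LinearMap.ker (LinearMap.proj (R := K) (φ := fun _ : Fin 5 => K) 0) := by
        refine Submodule.eq_of_le_of_finrank_eq (fun v hv => hinf v hv) ?_
        rw [hW, finrank_ker_of_ne_zero]
        intro h
        have := LinearMap.congr_fun h (Pi.single 0 1)
        simp at this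
      have hmem : ∀ v : Fin 5 → K, v 0 = 0 → v 1 ^ (sigmaExp e + 2) + v 2 ^ (sigmaExp e + 2) +
          v 3 ^ (sigmaExp e + 2) = 0 → v ∈ U := by
        intro v h0 hv
        refine hU v ?_ ((eval_varietyPoly_eq_zero_iff_of_zero he hε h0).mpr hv)
        rw [hWeq]
        exact h0
      have h2 : (2 : K) = 0 := CharTwo.two_eq_zero
      have hA : (![0, 1, 1, 0, 0] : Fin 5 → K) ∈ U :=
        hmem _ rfl (by simp [CharTwo.add_self_eq_zero])
      have hB : (![0, 1, 0, 1, 0] : Fin 5 → K) ∈ U :=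
        hmem _ rfl (by simp [CharTwo.add_self_eq_zero])
      obtain ⟨x, hx, hx0⟩ := exists_sum_pow_eq_zero_sum_ne_zero he hε
      rw [Fin.sum_univ_three] at hx hx0
      have hC : (![0, x 0, x 1, x 2, 0] : Fin 5 → K) ∈ U := hmem _ rfl hx
      intro v hv
      have hv0 := hinf v hv
      obtain ⟨k, hk⟩ : ∃ k, k * (x 0 + x 1 + x 2) = v 1 + v 2 + v 3 :=
        ⟨(v 1 + v 2 + v 3) / (x 0 + x 1 + x 2), by field_simp⟩
      have hveq : v = k • ![0, x 0, x 1, x 2, 0] + (v 2 - k * x 1) • ![0, 1, 1, 0, 0] +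
          (v 3 - k * x 2) • ![0, 1, 0, 1, 0] + v 4 • Pi.single 4 1 := by
        ext i
        fin_cases i
        · simpa using hv0
        · simp
          linear_combination -hk + (k * x 1 + k * x 2 - v 2 - v 3) * h2
        · simp
        · simp
        · simp
      rw [hveq]
      exact U.add_mem (U.add_mem (U.add_mem (U.smul_mem _ hC) (U.smul_mem _ hA))
        (U.smul_mem _ hB)) (U.smul_mem _ hlastU)
    · -- every affine point of the solid is joined to the vertex by a line with a second point of
      -- the variety
      simp only [not_forall] at hinf
      obtain ⟨w, hw, hw0⟩ := hinf
      have haff : ∀ v ∈ W, v 0 ≠ 0 → v ∈ U := by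
        intro v hv hv0
        obtain ⟨t, ht⟩ := relTrace_surjective hK hε (gamFixed hK hε ((v 0)⁻¹ * v 1) +
          gamFixed hK hε ((v 0)⁻¹ * v 2) + gamFixed hK hε ((v 0)⁻¹ * v 3))
        have h1 : (v 0)⁻¹ • v + (t - (v 0)⁻¹ * v 4) • (Pi.single 4 1 : Fin 5 → K) ∈ U := by
          refine hU _ (W.add_mem (W.smul_mem _ hv) (W.smul_mem _ hlast)) ?_
          rw [eval_varietyPoly_eq_zero_iff_of_one hK hε (by simp [hv0])]
          simp [ht]
        have h3 : (v 0)⁻¹ • v ∈ U := by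
          have := U.sub_mem h1 (U.smul_mem (t - (v 0)⁻¹ * v 4) hlastU)
          rwa [add_sub_cancel_right] at this
        exact (U.smul_mem_iff (inv_ne_zero hv0)).mp h3
      intro v hv
      by_cases hv0 : v 0 = 0
      · have h1 := haff (v + w) (W.add_mem hv hw) (by simpa [hv0] using hw0)
        have := U.sub_mem h1 (haff w hw hw0)
        rwa [add_sub_cancel_right] at this
      · exact haff v hv hv0
  -- a solid off the vertex
  obtain ⟨ψ, hψ, hWψ⟩ := Submodule.exists_le_ker_of_notMem hlast
  have hWeq : W = LinearMap.ker ψ := by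
    refine Submodule.eq_of_le_of_finrank_eq hWψ ?_
    rw [hW, finrank_ker_of_ne_zero]
    rintro rfl
    exact hψ rfl
  set α : K := -ψ (Pi.single 0 1) / ψ (Pi.single 4 1) with hα
  set β : Fin 3 → K := fun i =>
    -![ψ (Pi.single 1 1), ψ (Pi.single 2 1), ψ (Pi.single 3 1)] i / ψ (Pi.single 4 1) with hβ
  have hmemW : ∀ x : Fin 3 → K, ![1, x 0, x 1, x 2, α + ∑ i, β i * x i] ∈ W := by
    intro x
    rw [hWeq, LinearMap.mem_ker, linearMap_apply_fin_five]
    simp only [Matrix.cons_val, Fin.sum_univ_three, hα, hβ]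
    field_simp
    ring
  have hmemU : ∀ x : Fin 3 → K, ∑ i, gamFixed hK hε (x i) = relTrace hK (α + ∑ i, β i * x i) →
      ![1, x 0, x 1, x 2, α + ∑ i, β i * x i] ∈ U := by
    intro x hx
    refine hU _ (hmemW x) ?_
    rw [eval_varietyPoly_eq_zero_iff_of_one hK hε (by simp)]
    rw [Fin.sum_univ_three (fun i => gamFixed hK hε (x i))] at hx
    exact hx
  -- differences of two points of the variety give the coordinate directions of the solid
  have hdir : ∀ i : Fin 3, ∃ D ∈ W ⊓ U, D 0 = 0 ∧ D i.succ.castSucc ≠ 0 ∧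
      ∀ j : Fin 3, j ≠ i → D j.succ.castSucc = 0 := by
    intro i
    obtain ⟨x, x', hne, heq, h1, h2⟩ := exists_affine_pair hK hε he α β i
    refine ⟨_, (W ⊓ U).sub_mem ⟨hmemW x, hmemU x h1⟩ ⟨hmemW x', hmemU x' h2⟩, by simp, ?_, ?_⟩
    · have : x i - x' i ≠ 0 := sub_ne_zero.mpr hne
      fin_cases i <;> exact this
    · intro j hj
      have : x j - x' j = 0 := sub_eq_zero.mpr (heq j hj)
      fin_cases j <;> exact this
  choose D hDWU hD0 hDi hDj using hdir
  obtain ⟨x, -, -, -, hx, -⟩ := exists_affine_pair hK hε he α β 0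
  have hp : ![1, x 0, x 1, x 2, α + ∑ i, β i * x i] ∈ W ⊓ U := ⟨hmemW x, hmemU x hx⟩
  set p : Fin 5 → K := ![1, x 0, x 1, x 2, α + ∑ i, β i * x i] with hpdef
  have hp0 : p 0 = 1 := rfl
  intro v hv
  set s : Fin 5 → K := v 0 • p +
    ∑ i : Fin 3, ((v i.succ.castSucc - v 0 * p i.succ.castSucc) / D i i.succ.castSucc) • D i
    with hs
  have hsWU : s ∈ W ⊓ U := Submodule.add_mem _ (Submodule.smul_mem _ _ hp)
    (Submodule.sum_mem _ fun i _ => Submodule.smul_mem _ _ (hDWU i))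
  have hs0 : s 0 = v 0 := by simp [hs, hD0, hp0]
  have hsi : ∀ i : Fin 3, s i.succ.castSucc = v i.succ.castSucc := by
    intro i
    simp only [hs, Pi.add_apply, Pi.smul_apply, smul_eq_mul, Finset.sum_apply]
    rw [Finset.sum_eq_single i (fun j _ hj => by rw [hDj j i hj.symm, mul_zero]) (by simp),
      div_mul_cancel₀ _ (hDi i)]
    ring
  have hr : ψ (v - s) = 0 := by
    have : v - s ∈ W := W.sub_mem hv hsWU.1
    rwa [hWeq] at this
  have h1 : s 1 = v 1 := hsi 0
  have h2 : s 2 = v 2 := hsi 1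
  have h3 : s 3 = v 3 := hsi 2
  rw [linearMap_apply_fin_five] at hr
  simp only [Pi.sub_apply, hs0, h1, h2, h3, sub_self, zero_mul, zero_add] at hr
  have h4 : v 4 = s 4 := sub_eq_zero.mp ((mul_eq_zero.mp hr).resolve_right hψ)
  have hvs : v = s := by
    ext i
    fin_cases i
    · exact hs0.symm
    · exact h1.symm
    · exact h2.symm
    · exact h3.symm
    · exact h4
  rw [hvs]
  exact hsWU.2

/-- Some plane at infinity through the vertex `(0 : 0 : 0 : 0 : 1)` meets the variety only there:
the plane that joins the vertex to an external line of the curve at infinity. -/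
theorem exists_finrank_eq_three_tangent {ε : K} (hε : IsAdmissible e ε) (he : Odd e) :
    ∃ W : Submodule K (Fin 5 → K), Module.finrank K W = 3 ∧ (Pi.single 4 1 : Fin 5 → K) ∈ W ∧
      ∀ v ∈ W, MvPolynomial.eval v (varietyPoly 4 e ε) = 0 → v = Pi.single 4 (v 4) := by
  obtain ⟨d, hd, hC⟩ := exists_external_line he hε
  let φ : (Fin 5 → K) →ₗ[K] K :=
    d 0 • LinearMap.proj 1 + d 1 • LinearMap.proj 2 + d 2 • LinearMap.proj 3
  let f : (Fin 5 → K) →ₗ[K] K × K := (LinearMap.proj 0).prod φ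
  have hφ : ∀ v, φ v = d 0 * v 1 + d 1 * v 2 + d 2 * v 3 := fun v => rfl
  have hf : Function.Surjective f := by
    rintro ⟨a, b⟩
    have hv : ∃ v : Fin 5 → K, v 0 = 0 ∧ φ v = 1 := by
      obtain ⟨i, hi⟩ := Function.ne_iff.mp hd
      simp only [Pi.zero_apply] at hi
      refine ⟨Pi.single i.succ.castSucc (d i)⁻¹, ?_, ?_⟩
      · fin_cases i <;> simp
      · rw [hφ]
        fin_cases i <;> simp <;> exact mul_inv_cancel₀ hi
    obtain ⟨v, hv0, hv1⟩ := hv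
    refine ⟨a • Pi.single 0 1 + b • v, ?_⟩
    have h1 : φ (Pi.single 0 1) = 0 := by simp [hφ]
    ext
    · simp [f, hv0]
    · change φ _ = b
      rw [map_add, map_smul, map_smul, h1, hv1, smul_zero, zero_add, smul_eq_mul, mul_one]
  refine ⟨LinearMap.ker f, ?_, ?_, ?_⟩
  · have h := LinearMap.finrank_range_add_finrank_ker f
    rw [LinearMap.range_eq_top.mpr hf, finrank_top, Module.finrank_prod, Module.finrank_self,
      Module.finrank_fintype_fun_eq_card, Fintype.card_fin] at h
    omega
  · rw [LinearMap.mem_ker]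
    ext
    · simp [f]
    · change φ _ = 0
      simp [hφ]
  · intro v hv hev
    have h0 : v 0 = 0 := congrArg Prod.fst (LinearMap.mem_ker.mp hv)
    have h1 : φ v = 0 := congrArg Prod.snd (LinearMap.mem_ker.mp hv)
    rw [hφ] at h1
    rw [eval_varietyPoly_eq_zero_iff_of_zero he hε h0] at hev
    have h2 := hC ![v 1, v 2, v 3] (by rw [Fin.sum_univ_three]; exact h1)
      (by rw [Fin.sum_univ_three]; exact hev)
    ext i
    fin_cases i
    · simpa using h0
    · simpa using congrFun h2 0
    · simpa using congrFun h2 1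
    · simpa using congrFun h2 2
    · simp

/-- Some line is disjoint from the variety. -/
theorem exists_finrank_eq_two_disjoint {ε : K} (hε : IsAdmissible e ε) (he : Odd e) :
    ∃ W : Submodule K (Fin 5 → K), Module.finrank K W = 2 ∧
      ∀ v ∈ W, MvPolynomial.eval v (varietyPoly 4 e ε) = 0 → v = 0 := by
  obtain ⟨W, hW, hlast, hmem⟩ := exists_finrank_eq_three_tangent hε he
  let f : W →ₗ[K] K := (LinearMap.proj (R := K) (φ := fun _ : Fin 5 => K) 4).comp W.subtype
  have hf : f ≠ 0 := by
    intro h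
    have := LinearMap.congr_fun h ⟨_, hlast⟩
    simp [f] at this
  have h1 := Module.Dual.finrank_ker_add_one_of_ne_zero hf
  refine ⟨(LinearMap.ker f).map W.subtype, ?_, ?_⟩
  · rw [Submodule.finrank_map_subtype_eq]
    omega
  · rintro _ ⟨⟨v, hv⟩, hvf, rfl⟩ hev
    have h4 : v 4 = 0 := hvf
    have := hmem v hv hev
    rw [h4, Pi.single_zero] at this
    exact this

end Sections

/-! ### From linear to projective subspaces -/

section Projective

open Projectivization

variable {K V : Type*} [Field K] [AddCommGroup V] [Module K V]

theorem projDim_symm_submodule (W : Submodule K V) :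
    projDim (Subspace.submodule.symm W) = (Module.finrank K W : ℤ) - 1 := by
  rw [projDim, OrderIso.apply_symm_apply]

theorem mk_mem_symm_submodule (W : Submodule K V) {v : V} (hv : v ≠ 0) :
    Projectivization.mk K v hv ∈ Subspace.submodule.symm W ↔ v ∈ W := by
  rw [← Subspace.mem_submodule_iff, OrderIso.apply_symm_apply]

theorem neg_one_le_projDim (S : Projectivization.Subspace K V) : -1 ≤ projDim S := by
  unfold projDim
  omega

theorem projDim_span_empty :
    projDim (Subspace.span (∅ : Set (ℙ K V))) = -1 := by
  rw [Subspace.span_empty, projDim, OrderIso.map_bot, finrank_bot]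
  rfl

theorem projDim_mono [FiniteDimensional K V] {S T : Projectivization.Subspace K V} (h : S ≤ T) :
    projDim S ≤ projDim T := by
  have := Submodule.finrank_mono (Subspace.submodule.monotone h)
  unfold projDim
  omega

theorem projDim_span_nonneg [FiniteDimensional K V] {Ω : Set (ℙ K V)} (h : Ω.Nonempty) :
    0 ≤ projDim (Subspace.span Ω) := by
  obtain ⟨P, hP⟩ := h
  have h1 : P.rep ∈ Subspace.submodule (Subspace.span Ω) := by
    rw [Subspace.mem_submodule_iff _ P.rep_nonzero, mk_rep]
    exact Subspace.subset_span Ω hP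
  have h2 : 0 < Module.finrank K (Subspace.submodule (Subspace.span Ω)) :=
    Module.finrank_pos_iff_exists_ne_zero.mpr
      ⟨⟨_, h1⟩, fun h => P.rep_nonzero (congrArg Subtype.val h)⟩
  unfold projDim
  omega

theorem projDim_span_singleton (P : ℙ K V) [FiniteDimensional K V] :
    projDim (Subspace.span {P}) = 0 := by
  refine le_antisymm ?_ (projDim_span_nonneg (Set.singleton_nonempty P))
  have h : Subspace.span {P} ≤ Subspace.submodule.symm (K ∙ P.rep) := by
    rw [Subspace.span_le_subspace_iff, Set.singleton_subset_iff]
    have := (mk_mem_symm_submodule (K ∙ P.rep) P.rep_nonzero).mpr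
      (Submodule.mem_span_singleton_self _)
    rwa [mk_rep] at this
  refine (projDim_mono h).trans ?_
  rw [projDim_symm_submodule, finrank_span_singleton P.rep_nonzero]
  rfl

end Projective

end CuttingGap

open CuttingGap Projectivization in
theorem mainTheorem8 {K : Type*} [Field K] [Finite K] (e : ℕ) (he : Odd e) (he1 : 1 < e)
    (hK : Nat.card K = (2 ^ e) ^ 2) (ε : K) (hε : CuttingGap.IsAdmissible e ε) :
    CuttingGap.cuttingGap (CuttingGap.variety 4 e ε) 1 = 2 ∧
    CuttingGap.cuttingGap (CuttingGap.variety 4 e ε) 2 = 2 ∧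
    CuttingGap.cuttingGap (CuttingGap.variety 4 e ε) 3 = 0 ∧
    (∃ L : Projectivization.Subspace K (Fin 5 → K), CuttingGap.projDim L = 1 ∧
      (L : Set (ℙ K (Fin 5 → K))) ∩ CuttingGap.variety 4 e ε = ∅) ∧
    (∃ S : Projectivization.Subspace K (Fin 5 → K), CuttingGap.projDim S = 2 ∧
      ∃ P : ℙ K (Fin 5 → K), (S : Set (ℙ K (Fin 5 → K))) ∩ CuttingGap.variety 4 e ε = {P}) ∧
    (∀ S : Projectivization.Subspace K (Fin 5 → K), CuttingGap.projDim S = 2 →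
      ((S : Set (ℙ K (Fin 5 → K))) ∩ CuttingGap.variety 4 e ε).Nonempty) := by
  have := Fintype.ofFinite K
  rw [Nat.card_eq_fintype_card] at hK
  have : CharP K 2 := charP_of_card_eq_prime_pow (f := e * 2) (by rw [hK, pow_mul])
  have hline : ∃ L : Projectivization.Subspace K (Fin 5 → K), projDim L = 1 ∧
      (L : Set (ℙ K (Fin 5 → K))) ∩ variety 4 e ε = ∅ := by
    obtain ⟨W, hW, hmem⟩ := exists_finrank_eq_two_disjoint hε he
    refine ⟨Subspace.submodule.symm W, by rw [projDim_symm_submodule, hW]; rfl, ?_⟩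
    rw [Set.eq_empty_iff_forall_notMem]
    rintro P ⟨hPW, hP⟩
    induction P using Projectivization.ind with | h v hv =>
    exact hv (hmem v ((mk_mem_symm_submodule W hv).mp hPW) ((mk_mem_variety_iff 4 e ε v hv).mp hP))
  have hpoint : ∃ S : Projectivization.Subspace K (Fin 5 → K), projDim S = 2 ∧
      ∃ P : ℙ K (Fin 5 → K), (S : Set (ℙ K (Fin 5 → K))) ∩ variety 4 e ε = {P} := by
    obtain ⟨W, hW, hlast, hmem⟩ := exists_finrank_eq_three_tangent hε he
    have hne : (Pi.single 4 1 : Fin 5 → K) ≠ 0 := by simp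
    refine ⟨Subspace.submodule.symm W, by rw [projDim_symm_submodule, hW]; rfl,
      Projectivization.mk K _ hne, Set.eq_singleton_iff_unique_mem.mpr ⟨⟨?_, ?_⟩, ?_⟩⟩
    · exact (mk_mem_symm_submodule W hne).mpr hlast
    · exact (mk_mem_variety_iff 4 e ε _ hne).mpr (eval_varietyPoly_single_last he hε 1)
    · rintro P ⟨hPW, hP⟩
      induction P using Projectivization.ind with | h v hv =>
      have h1 := hmem v ((mk_mem_symm_submodule W hv).mp hPW)
        ((mk_mem_variety_iff 4 e ε v hv).mp hP)
      rw [Projectivization.mk_eq_mk_iff']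
      exact ⟨v 4, by conv_rhs => rw [h1]
                     simp [← Pi.single_smul]⟩
  have hplane : ∀ S : Projectivization.Subspace K (Fin 5 → K), projDim S = 2 →
      ((S : Set (ℙ K (Fin 5 → K))) ∩ variety 4 e ε).Nonempty := by
    intro S hS
    obtain ⟨v, hvS, hv, hev⟩ := exists_mem_of_finrank_eq_three hK hε he
      (W := Subspace.submodule S) (by unfold projDim at hS; omega)
    exact ⟨Projectivization.mk K v hv, (Subspace.mem_submodule_iff S hv).mp hvS,
      (mk_mem_variety_iff 4 e ε v hv).mpr hev⟩
  have hsolid : ∀ S : Projectivization.Subspace K (Fin 5 → K), projDim S = 3 →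
      Subspace.span ((S : Set (ℙ K (Fin 5 → K))) ∩ variety 4 e ε) = S := by
    intro S hS
    refine Subspace.span_eq_of_le Set.inter_subset_left ?_
    rw [← Subspace.submodule.le_iff_le]
    refine le_of_finrank_eq_four hK hε he (by unfold projDim at hS; omega) fun v hv hev => ?_
    by_cases hv0 : v = 0
    · rw [hv0]; exact Submodule.zero_mem _
    · rw [Subspace.mem_submodule_iff _ hv0] at hv ⊢
      exact Subspace.subset_span _ ⟨hv, (mk_mem_variety_iff 4 e ε v hv0).mpr hev⟩
  refine ⟨?_, ?_, ?_, hline, hpoint, hplane⟩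
  · have h : IsLeast (sectionDims (variety 4 e ε) 1) (-1) := by
      obtain ⟨L, hL, hdisj⟩ := hline
      refine ⟨⟨L, hL, by rw [hdisj, projDim_span_empty]⟩, ?_⟩
      rintro _ ⟨S, -, rfl⟩
      exact neg_one_le_projDim _
    rw [cuttingGap, h.csInf_eq]
    rfl
  · have h : IsLeast (sectionDims (variety 4 e ε) 2) 0 := by
      obtain ⟨S, hS, P, hP⟩ := hpoint
      refine ⟨⟨S, hS, by rw [hP, projDim_span_singleton]⟩, ?_⟩
      rintro _ ⟨T, hT, rfl⟩
      exact projDim_span_nonneg (hplane T hT)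
    rw [cuttingGap, h.csInf_eq]
    rfl
  · have h : IsLeast (sectionDims (variety 4 e ε) 3) 3 := by
      constructor
      · have hW : projDim (Subspace.submodule.symm (LinearMap.ker
            (LinearMap.proj (R := K) (φ := fun _ : Fin 5 => K) 0))) = 3 := by
          rw [projDim_symm_submodule, finrank_ker_of_ne_zero]
          · rfl
          · intro h
            have := LinearMap.congr_fun h (Pi.single 0 1)
            simp at this
        exact ⟨_, hW, by rw [hsolid _ hW, hW]⟩
      · rintro _ ⟨S, hS, rfl⟩
        rw [hsolid S hS, hS]
        rfl
    rw [cuttingGap, h.csInf_eq]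
    rfl
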